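/- \textbf{Setting.} Let $0\le l'\le L$, $m,n\ge 1$, widths $d_0,\dots,d_L$ and orders $s_0,\dots,s_L$ with $s_l>d_l/2$. Let $M\in\mathbb R^{m\times m}$ be symmetric positive semidefinite. For a finite-dimensional Euclidean space $V$ and $s>\dim V/2$ put $\hat f(\omega)=(2\pi)^{-\dim V/2}\int_V f(x)e^{i\langle x,\omega\rangle}dx$ (in the $L^2$ sense), and let $k_s$ be the reproducing kernel of the scalar Sobolev space with norm $\big(\int_V(1+\|\omega\|^2)^s|\hat f(\omega)|^2d\omega\big)^{1/2}$, i.e. $k_s(x,y)=(2\pi)^{-\dim V}\int_V(1+\|\omega\|^2)^{-s}\cos\langle\omega,x-y\rangle\,d\omega$. Let $H^s(V,\mathbb R^m)$ be the vector-valued reproducing kernel Hilbert space with kernel $K_s=k_sM$: the functions $f=M^{1/2}u$, where $u:V\to\mathbb R^m$ is continuous, square integrable and has $\int_V(1+\|\omega\|^2)^s\|\hat u(\omega)\|^2d\omega<\infty$, with $\|f\|_{H^s}$ the infimum of $\big(\int_V(1+\|\omega\|^2)^s\|\hat u\|^2d\omega\big)^{1/2}$ over such $u$. (For $M=I$ this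 is the Sobolev space with its usual norm.) Let $\sigma_l:\mathbb R^{d_l}\to\mathbb R^{d_l}$ ($1\le l\le L$) be activation functions, $b_l(x)=x+a_l$ shifts with bias $a_l\in\mathbb R^{d_l}$, and $g\in H^{s_L}(\mathbb R^{d_L},\mathbb R^m)$. For $C,D>0$ let $\mathcal W_l$ be the set of the $W\in\mathbb R^{d_l\times d_{l-1}}$ with $d_l\ge d_{l-1}$, $\|W\|\le C$ (operator norm) and $\det(W^\top W)^{1/2}\ge D$; let $B_l\subseteq\mathbb R^{d_l}$ be any set of admissible biases (for instance all of $\mathbb R^{d_l}$). Assume that for $1\le l\le l'$ the Koopman operator $\mathcal K_{\sigma_l}f=f\circ\sigma_l$ is bounded on $H^{s_l}(\mathbb R^{d_l},\mathbb R^m)$, with operator norm $\|\mathcal K_{\sigma_l}\|$, and that for every $W\in\mathcal W_l$ the operator $\mathcal K_Wf=f\circ W$ maps $H^{s_l}(\mathbb R^{d_l},\mathbb R^m)$ into $H^{s_{l-1}}(\mathbb R^{d_{l-1}},\mathbb R^m)$. Let $$\mathcal F^{1:l'}_{\rm inj}=\{\sigma_{l'}\circ b_{l'}\circ W_{l'}\circ\cdots\circ\sigma_1\circ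 b_1\circ W_1 \;:\; W_l\in\mathcal W_l,\ a_l\in B_l\},$$ and let $\mathcal F^{l'+1:L}$ be any nonempty set of functions in $H^{s_{l'}}(\mathbb R^{d_{l'}},\mathbb R^m)$ of the form $g\circ b_L\circ W_L\circ\sigma_{L-1}\circ\cdots\circ\sigma_{l'+1}\circ b_{l'+1}\circ W_{l'+1}$ with arbitrary weights and biases (for $l'=L$: $\mathcal F^{L+1:L}=\{g\}$). Put $\mathcal F_{\rm comb}=\{h\circ f : h\in\mathcal F^{l'+1:L},\ f\in\mathcal F^{1:l'}_{\rm inj}\}$. Given $x_1,\dots,x_n\in\mathbb R^{d_0}$ and $\tilde x_1,\dots,\tilde x_n\in\mathbb R^{d_{l'}}$, let $\boldsymbol\sigma_1,\dots,\boldsymbol\sigma_n$ be independent and uniform on $\{-1,1\}^m$, and for a class $\mathcal F$ and points $z_1,\dots,z_n$ let $\hat{\mathfrak R}_z(\mathcal F)=\mathbb E\big[\sup_{f\in\mathcal F}\frac1n\big|\sum_i\langle\boldsymbol\sigma_i,f(z_i)\rangle\big|\big]$. Let $\upsilon_n=\sum_iK_{s_0}(\cdot,x_i)\boldsymbol\sigma_i$,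 $\tilde\upsilon_n=\sum_iK_{s_{l'}}(\cdot,\tilde x_i)\boldsymbol\sigma_i$ and $\gamma_n=\|\upsilon_n\|_{H^{s_0}}/\|\tilde\upsilon_n\|_{H^{s_{l'}}}$, where it is assumed that $\tilde\upsilon_n\ne0$ for every value of the signs. Let $\kappa$ satisfy $k_{s_{l'}}(y,y')\le\kappa$ for all $y,y'\in\mathbb R^{d_{l'}}$. \textbf{Theorem.} With $\mathcal R(W)$ the range of $W$, $f_l=h\circ(\sigma_{l'}\circ b_{l'}\circ W_{l'})\circ\cdots\circ(\sigma_{l+1}\circ b_{l+1}\circ W_{l+1})\circ\sigma_l\circ b_l$ and $$G_l=\frac{\big\|f_l|_{\mathcal R(W_l)}\big\|_{H^{s_{l-1}}(\mathcal R(W_l),\mathbb R^m)}}{\|f_l\|_{H^{s_l}(\mathbb R^{d_l},\mathbb R^m)}}\qquad(0/0:=0),$$ one has, in $[0,\infty]$ (with $0\cdot\infty=0$), $$\hat{\mathfrak R}_x(\mathcal F_{\rm comb})\le\Bigg(\sup\prod_{l=1}^{l'}G_l\ \sup_{\omega\in\mathcal R(W_l)}\left|\frac{1+\|W_l^\top\omega\|^2}{1+\|\omega\|^2}\right|^{s_{l-1}/2}\frac{\|\mathcal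 K_{\sigma_l}\|}{\det(W_l^\top W_l)^{1/4}}\Bigg)\Bigg(\hat{\mathfrak R}_{\tilde x}(\mathcal F^{l'+1:L})+\sqrt{\frac{\kappa}{n}\operatorname{Tr}M}\ \inf_{h'\in\mathcal F^{l'+1:L}}\mathbb E^{1/2}\Big[\sup_{h''\in\mathcal F^{l'+1:L}}\Big\|h'-\frac{\gamma_n\|h''\|_{H^{s_{l'}}}}{\|\tilde\upsilon_n\|_{H^{s_{l'}}}}\tilde\upsilon_n\Big\|^2_{H^{s_{l'}}}\Big]\Bigg),$$ where the first supremum is over all $W_l\in\mathcal W_l$, $a_l\in B_l$ ($1\le l\le l'$) and all $h\in\mathcal F^{l'+1:L}$, i.e. over everything that the ratios $G_l$ depend on. -/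

import Mathlib

open MeasureTheory FourierTransform
open scoped ENNReal NNReal MatrixOrder

noncomputable section

namespace KoopmanNet

/-- Euclidean space `ℝᵏ` with its Euclidean norm. -/
abbrev E (k : ℕ) : Type := EuclideanSpace ℝ (Fin k)

section Sobolev

variable {V : Type*} [NormedAddCommGroup V] [InnerProductSpace ℝ V] [FiniteDimensional ℝ V]
  [MeasurableSpace V] [BorelSpace V] {m : ℕ}

/-- An `ℝᵐ`-valued function, read as a `ℂᵐ`-valued function. -/
def complexify (f : V → E m) : V → EuclideanSpace ℂ (Fin m) :=
  fun x => WithLp.toLp 2 fun i => ((f x i : ℝ) : ℂ)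

/-- The norm `‖f‖ = (∫ (1 + ‖ω‖²)ˢ ‖f̂(ω)‖² dω)^(1/2)` of the Sobolev space `Hˢ(V, ℝᵐ)`, where
`f̂(ω) = (2π)^(-dim V / 2) ∫ f(x) e^{i⟨x, ω⟩} dx` (in the `L²` sense). It is `∞` on functions
outside the space; since `s > dim V / 2` wherever the norm is used, elements of the space are taken
to be the continuous representatives.

Mathlib's Fourier transform is `𝓕 f (ξ) = ∫ f(x) e^{-2πi⟨x, ξ⟩} dx`, so that
`f̂(-2πξ) = (2π)^(-dim V / 2) 𝓕 f (ξ)`, and the substitution `ω = -2πξ` turns the integral above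
into the one below, with no further constant. -/
def sobNorm (s : ℝ) (f : V → E m) : ℝ≥0∞ :=
  ⨅ (_ : Continuous f) (hf : MemLp (complexify f) 2 (volume : Measure V)),
    (∫⁻ ξ, ENNReal.ofReal ((1 + ‖(2 * Real.pi) • ξ‖ ^ 2) ^ s) *
      ‖(𝓕 (hf.toLp (complexify f)) : Lp (EuclideanSpace ℂ (Fin m)) 2 (volume : Measure V)) ξ‖ₑ ^ 2)
      ^ (1 / 2 : ℝ)

/-- The reproducing kernel of the scalar space `Hˢ(V)`,
`k_s(x, y) = (2π)^(-dim V) ∫ (1 + ‖ω‖²)^(-s) cos ⟨ω, x - y⟩ dω`, written with `ω = 2πξ`. -/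
def sobKernel (s : ℝ) (x y : V) : ℝ :=
  ∫ ξ : V, (1 + ‖(2 * Real.pi) • ξ‖ ^ 2) ^ (-s) * Real.cos (2 * Real.pi * inner ℝ ξ (x - y))

/-- The norm of the vector-valued reproducing kernel Hilbert space `Hˢ(V, ℝᵐ)` whose kernel is
`K_s(x, y) = k_s(x, y) M`: the space of the functions `M^{1/2} ∘ u` with `u` in the Sobolev space,
with the quotient norm. For `M = 1` it is `sobNorm s`; for invertible `M` its square is
`∫ (1 + ‖ω‖²)ˢ f̂(ω)^* M⁻¹ f̂(ω) dω`. It is `∞` exactly on the functions outside the space. -/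
def rkhsNorm (s : ℝ) (M : Matrix (Fin m) (Fin m) ℝ) (f : V → E m) : ℝ≥0∞ :=
  ⨅ (u : V → E m) (_ : f = fun x => Matrix.toEuclideanLin (CFC.sqrt M) (u x)), sobNorm s u

/-- Membership in `Hˢ(V, ℝᵐ)`. -/
def MemRkhs (s : ℝ) (M : Matrix (Fin m) (Fin m) ℝ) (f : V → E m) : Prop :=
  rkhsNorm s M f < ∞

/-- The operator norm on `Hˢ(V, ℝᵐ)` of the Koopman operator `K_σ f = f ∘ σ`; it is finite if and
only if `K_σ` is a bounded operator on the whole space. -/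
def koopmanNorm (s : ℝ) (M : Matrix (Fin m) (Fin m) ℝ) (σ : V → V) : ℝ≥0∞ :=
  ⨆ (f : V → E m) (_ : rkhsNorm s M f ≤ 1), rkhsNorm s M (fun x => f (σ x))

end Sobolev

section Rademacher

variable {V : Type*} {n m : ℕ}

/-- All `n`-tuples of sign vectors in `{-1, 1}ᵐ`. -/
abbrev Signs (n m : ℕ) : Type := Fin n → Fin m → ℤˣ

/-- The `i`-th Rademacher vector, as an element of `ℝᵐ`. -/
def signVec (ε : Signs n m) (i : Fin n) : E m :=
  WithLp.toLp 2 fun j => (((ε i j : ℤˣ) : ℤ) : ℝ)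

/-- Expectation with respect to independent uniform signs. -/
def expect (φ : Signs n m → ℝ≥0∞) : ℝ≥0∞ :=
  (∑ ε, φ ε) / (Fintype.card (Signs n m) : ℝ≥0∞)

/-- The empirical vector-valued Rademacher complexity of `F` at the points `x₁, …, xₙ`. -/
def rademacher (x : Fin n → V) (F : Set (V → E m)) : ℝ≥0∞ :=
  expect fun ε : Signs n m =>
    ⨆ f ∈ F, ‖∑ i, inner ℝ (signVec ε i) (f (x i))‖ₑ / (n : ℝ≥0∞)

/-- The random function `∑ᵢ K_s(·, xᵢ) σᵢ` with `K_s = k_s M`. -/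
def kernelSum [NormedAddCommGroup V] [InnerProductSpace ℝ V] [FiniteDimensional ℝ V]
    [MeasurableSpace V] [BorelSpace V]
    (s : ℝ) (M : Matrix (Fin m) (Fin m) ℝ) (x : Fin n → V) (ε : Signs n m) : V → E m :=
  fun y => ∑ i, sobKernel s y (x i) • Matrix.toEuclideanLin M (signVec ε i)

end Rademacher

section Networks

/-! Layers are numbered from `0`: layer `k` maps `ℝ^{d k}` to `ℝ^{d (k + 1)}`, with weight matrix
`W k`, bias `a k` and activation `σ k`. -/

variable {d : ℕ → ℕ} {m : ℕ}

/-- The weight matrices with `‖W‖ ≤ C` (operator norm) and `det (Wᵀ W)^{1/2} ≥ D`. -/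
def weightSet (C D : ℝ) (p q : ℕ) : Set (Matrix (Fin q) (Fin p) ℝ) :=
  {W | p ≤ q ∧ ‖LinearMap.toContinuousLinearMap (Matrix.toEuclideanLin W)‖ ≤ C ∧
    D ≤ (W.transpose * W).det ^ (1 / 2 : ℝ)}

/-- The affine map `b_k ∘ W_k`. -/
def affine (W : ∀ k, Matrix (Fin (d (k + 1))) (Fin (d k)) ℝ) (a : ∀ k, E (d (k + 1))) (k : ℕ)
    (x : E (d k)) : E (d (k + 1)) :=
  Matrix.toEuclideanLin (W k) x + a k

/-- The composition `T_{j-1} ∘ ⋯ ∘ T_i` (the identity if `i = j`). -/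
def layers (T : ∀ k, E (d k) → E (d (k + 1))) {i j : ℕ} (hij : i ≤ j) (x : E (d i)) : E (d j) :=
  Nat.leRecOn (C := fun k => E (d k)) hij (fun {k} => T k) x

/-- The full layer `σ_k ∘ b_k ∘ W_k`. -/
def fullLayer (σ : ∀ k, E (d (k + 1)) → E (d (k + 1)))
    (W : ∀ k, Matrix (Fin (d (k + 1))) (Fin (d k)) ℝ) (a : ∀ k, E (d (k + 1))) (k : ℕ)
    (x : E (d k)) : E (d (k + 1)) :=
  σ k (affine W a k x)

/-- The layers of the upper part of an `L`-layer network: no activation after the last of them. -/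
def upperLayer (L : ℕ) (σ : ∀ k, E (d (k + 1)) → E (d (k + 1)))
    (W : ∀ k, Matrix (Fin (d (k + 1))) (Fin (d k)) ℝ) (a : ∀ k, E (d (k + 1))) (k : ℕ)
    (x : E (d k)) : E (d (k + 1)) :=
  if k + 1 = L then affine W a k x else fullLayer σ W a k x

/-- All functions `g ∘ b_{L-1} ∘ W_{L-1} ∘ σ_{L-2} ∘ ⋯ ∘ σ_l ∘ b_l ∘ W_l`; for `l = L`, only `g`. -/
def upperNetworks {L l : ℕ} (hl : l ≤ L) (σ : ∀ k, E (d (k + 1)) → E (d (k + 1)))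
    (g : E (d L) → E m) : Set (E (d l) → E m) :=
  {h | ∃ (W : ∀ k, Matrix (Fin (d (k + 1))) (Fin (d k)) ℝ) (a : ∀ k, E (d (k + 1))),
    h = fun x => g (layers (upperLayer L σ W a) hl x)}

/-- The admissible parameters of the first `l` layers: weights in `weightSet`, and biases in
prescribed sets. -/
def LowerParams (l : ℕ) (C D : ℝ) (B : ∀ k, Set (E (d (k + 1))))
    (W : ∀ k, Matrix (Fin (d (k + 1))) (Fin (d k)) ℝ) (a : ∀ k, E (d (k + 1))) : Prop :=
  ∀ k < l, W k ∈ weightSet C D (d k) (d (k + 1)) ∧ a k ∈ B k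

/-- The functions `σ_{l-1} ∘ b_{l-1} ∘ W_{l-1} ∘ ⋯ ∘ σ_0 ∘ b_0 ∘ W_0` with admissible
parameters. -/
def lowerNetworks (l : ℕ) (C D : ℝ) (B : ∀ k, Set (E (d (k + 1))))
    (σ : ∀ k, E (d (k + 1)) → E (d (k + 1))) : Set (E (d 0) → E (d l)) :=
  {f | ∃ W a, LowerParams l C D B W a ∧ f = layers (fullLayer σ W a) (Nat.zero_le l)}

/-- The part `h ∘ (σ_{l-1} ∘ b_{l-1} ∘ W_{l-1}) ∘ ⋯ ∘ σ_k ∘ b_k` of a network that follows the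
weight matrix `W_k`, where `h` stands for the upper layers. -/
def tail {l : ℕ} (σ : ∀ k, E (d (k + 1)) → E (d (k + 1)))
    (W : ∀ k, Matrix (Fin (d (k + 1))) (Fin (d k)) ℝ) (a : ∀ k, E (d (k + 1)))
    (h : E (d l) → E m) (k : Fin l) : E (d (k + 1)) → E m :=
  fun y => h (layers (fullLayer σ W a) k.isLt (σ k (y + a k)))

/-- The ratio `‖f|_{R(W)}‖ / ‖f‖` of the norm of `f|_{R(W)}` in `H^{s₀}(R(W), ℝᵐ)` and the norm of
`f` in `H^{s₁}(ℝ^q, ℝᵐ)`. -/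
def normRatio {p q : ℕ} (s₀ s₁ : ℝ) (M : Matrix (Fin m) (Fin m) ℝ) (W : Matrix (Fin q) (Fin p) ℝ)
    (f : E q → E m) : ℝ≥0∞ :=
  rkhsNorm s₀ M (fun y : LinearMap.range (Matrix.toEuclideanLin W) => f y) / rkhsNorm s₁ M f

/-- `sup_{ω ∈ R(W)} |(1 + ‖Wᵀ ω‖²) / (1 + ‖ω‖²)|^{s/2}`. -/
def fourierRatio {p q : ℕ} (s : ℝ) (W : Matrix (Fin q) (Fin p) ℝ) : ℝ≥0∞ :=
  ⨆ ω ∈ LinearMap.range (Matrix.toEuclideanLin W),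
    ENNReal.ofReal
      (|(1 + ‖Matrix.toEuclideanLin W.transpose ω‖ ^ 2) / (1 + ‖ω‖ ^ 2)| ^ (s / 2))

/-- The factor contributed by layer `k`. -/
def layerFactor {l : ℕ} (s : ℕ → ℝ) (M : Matrix (Fin m) (Fin m) ℝ)
    (σ : ∀ k, E (d (k + 1)) → E (d (k + 1)))
    (W : ∀ k, Matrix (Fin (d (k + 1))) (Fin (d k)) ℝ) (a : ∀ k, E (d (k + 1)))
    (h : E (d l) → E m) (k : Fin l) : ℝ≥0∞ :=
  normRatio (s k) (s (k + 1)) M (W k) (tail σ W a h k) *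
    fourierRatio (s k) (W k) *
    (koopmanNorm (s (k + 1)) M (σ k) /
      ENNReal.ofReal (((W k).transpose * W k).det ^ (1 / 4 : ℝ)))

end Networks

section Approximation

variable {V V₀ : Type*} {n m : ℕ}
  [NormedAddCommGroup V] [InnerProductSpace ℝ V] [FiniteDimensional ℝ V]
  [MeasurableSpace V] [BorelSpace V]
  [NormedAddCommGroup V₀] [InnerProductSpace ℝ V₀] [FiniteDimensional ℝ V₀]
  [MeasurableSpace V₀] [BorelSpace V₀]

/-- The approximation term `inf_{h' ∈ F} E^{1/2} [sup_{h'' ∈ F} ‖h' - (γ ‖h''‖ / ‖v‖) v‖²]`, where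
`v₀ = ∑ᵢ K_{s₀}(·, xᵢ) σᵢ`, `v = ∑ᵢ K_s(·, x̃ᵢ) σᵢ`, `γ = ‖v₀‖ / ‖v‖`. -/
def approxTerm (s₀ s : ℝ) (M : Matrix (Fin m) (Fin m) ℝ) (x : Fin n → V₀) (xt : Fin n → V)
    (F : Set (V → E m)) : ℝ≥0∞ :=
  ⨅ h' ∈ F, (expect fun ε : Signs n m => ⨆ h'' ∈ F,
    rkhsNorm s M (fun y => h' y -
      (rkhsNorm s₀ M (kernelSum s₀ M x ε) / rkhsNorm s M (kernelSum s M xt ε) *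
        rkhsNorm s M h'' / rkhsNorm s M (kernelSum s M xt ε)).toReal •
          kernelSum s M xt ε y) ^ 2) ^ (1 / 2 : ℝ)

end Approximation

end KoopmanNet

end

/-! For signs `ε`, the sum `∑ᵢ ⟨σᵢ, f(xᵢ)⟩` is the inner product of `f` with the kernel sum `υ` at
the points `xᵢ`, so it is at most `‖υ‖ ‖f‖` (`enorm_sum_inner_le_rkhsNorm`, `rkhsNorm_kernelSum`).
For a network `f = h ∘ f₂` the norm is peeled off layer by layer: a shift does not increase it, an
activation costs its Koopman norm, and an injective `W` is restriction to its range followed by a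
linear change of variables, where Lebesgue measure gives `det(WᵀW)^{-1/4}` and the Fourier weight
gives `fourierRatio` (`rkhsNorm_comp_matrix_le`, `rkhsNorm_network_le`). Hence the complexity is at
most the supremum of the layer products times `E sup_h ‖υ‖ ‖h‖ / n`.

To bring back the complexity of the upper layers, let `υ̃` be the kernel sum at the points `x̃ᵢ` and
write `‖υ‖ ‖h‖ = ⟨υ̃, c υ̃⟩` with `c = γ ‖h‖ / ‖υ̃‖`. For any `h'` in the class this is `⟨υ̃, h'⟩ -
⟨υ̃, h' - c υ̃⟩`. The first term is a Rademacher sum of `h'`; the second is handled by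
Cauchy–Schwarz, in the function space and then over the signs, with `E ‖υ̃‖² ≤ n κ Tr M`
(`mul_rkhsNorm_le`, `expect_iSup_rkhsNorm_le`).

Inner products of the function space are never built. They are replaced by pairings of Fourier
transforms, and `M` enters only through its square root. -/

noncomputable section

namespace KoopmanNet

/-! ### The inverse Fourier transform on `L¹ ∩ L²`. -/

section L2Fourier

variable {V F : Type*} [NormedAddCommGroup V] [InnerProductSpace ℝ V] [FiniteDimensional ℝ V]
  [MeasurableSpace V] [BorelSpace V]
  [NormedAddCommGroup F] [InnerProductSpace ℂ F]

theorem continuous_fourierInv {w : V → F} (hw : Integrable w) : Continuous (𝓕⁻ w) :=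
  VectorFourier.fourierIntegral_continuous Real.continuous_fourierChar
    (by simpa using! continuous_inner.neg) hw

variable [CompleteSpace F]

/-- The integral formula for the inverse Fourier transform agrees with its `L²` extension on
`L¹ ∩ L²`. -/
theorem coeFn_fourierInv_toLp {w : V → F} (h1 : Integrable w) (h2 : MemLp w 2) :
    ⇑(𝓕⁻ (h2.toLp w) : Lp F 2 (volume : Measure V)) =ᵐ[volume] 𝓕⁻ w := by
  apply ae_eq_of_integral_contDiff_smul_eq
  · exact (Lp.memLp _).locallyIntegrable one_le_two
  · exact (continuous_fourierInv h1).locallyIntegrable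
  intro g hg hgc
  have hg₁ : HasCompactSupport (Complex.ofRealCLM ∘ g) := hgc.comp_left rfl
  have hg₂ : ContDiff ℝ ((⊤ : ℕ∞) : WithTop ℕ∞) (Complex.ofRealCLM ∘ g) := by fun_prop
  set φ := hg₁.toSchwartzMap hg₂ with hφ
  have hφa : ∀ x, φ x = (g x : ℂ) := fun _ => rfl
  -- The transform is moved onto the test function on both sides: for the `L²` extension by its
  -- agreement with the transform of tempered distributions, for the integral formula by Fubini.
  have key : ∫ x, φ x • (𝓕⁻ (h2.toLp w) : Lp F 2 (volume : Measure V)) x =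
      ∫ x, φ x • 𝓕⁻ w x := by
    have e1 := congrArg (fun T => T φ) (Lp.fourierInv_toTemperedDistribution_eq (h2.toLp w))
    simp only [TemperedDistribution.fourierInv_apply, Lp.toTemperedDistribution_apply] at e1
    rw [← e1]
    have e2 := VectorFourier.integral_fourierIntegral_smul_eq_flip (L := -innerₗ V)
      (μ := (volume : Measure V)) (ν := (volume : Measure V)) (f := φ) (g := w)
      Real.continuous_fourierChar (by simpa using! continuous_inner.neg) φ.integrable h1
    have e3 : ∫ x, (𝓕⁻ φ) x • (h2.toLp w) x = ∫ x, (𝓕⁻ φ) x • w x := by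
      apply integral_congr_ae
      filter_upwards [h2.coeFn_toLp] with x hx
      rw [hx]
    rw [e3, SchwartzMap.fourierInv_coe]
    convert! e2 using 4
    rename_i x
    have : (-innerₗ V).flip = -innerₗ V := by
      ext a b; simp [real_inner_comm]
    rw [this]
    rfl
  simpa [hφa] using! key

theorem fourier_toLp_eq {u w : V → F} (h1 : Integrable w) (h2 : MemLp w 2) (hu : MemLp u 2)
    (h : u = 𝓕⁻ w) : (𝓕 (hu.toLp u) : Lp F 2 (volume : Measure V)) = h2.toLp w := by
  have : hu.toLp u = 𝓕⁻ (h2.toLp w) := by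
    apply Lp.ext
    filter_upwards [hu.coeFn_toLp, coeFn_fourierInv_toLp h1 h2] with x e1 e2
    rw [e1, e2, h]
  rw [this, fourier_fourierInv_eq]

theorem memLp_fourierInv {w : V → F} (h1 : Integrable w) (h2 : MemLp w 2) : MemLp (𝓕⁻ w) 2 :=
  (memLp_congr_ae (coeFn_fourierInv_toLp h1 h2)).mp (Lp.memLp _)

/-- Continuous functions that agree almost everywhere agree everywhere; this upgrades `L²` inversion
to pointwise values, which the reproducing property needs. -/
theorem eq_fourierInv_of_continuous {u w : V → F} (hc : Continuous u) (hu : MemLp u 2)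
    (h1 : Integrable w)
    (h : ⇑(𝓕 (hu.toLp u) : Lp F 2 (volume : Measure V)) =ᵐ[volume] w) : u = 𝓕⁻ w := by
  have h2 : MemLp w 2 := (memLp_congr_ae h).mp (Lp.memLp _)
  refine (hc.ae_eq_iff_eq (volume : Measure V) (continuous_fourierInv h1)).mp ?_
  have e : (𝓕 (hu.toLp u) : Lp F 2 (volume : Measure V)) = h2.toLp w :=
    Lp.ext (h.trans h2.coeFn_toLp.symm)
  have e' : hu.toLp u = 𝓕⁻ (h2.toLp w) := by rw [← e, fourierInv_fourier_eq]
  filter_upwards [hu.coeFn_toLp, coeFn_fourierInv_toLp h1 h2] with x e1 e2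
  rw [← e1, e', e2]

end L2Fourier

/-! ### Weighted `L²` norms on the Fourier side. -/

section Energy

variable {V : Type*} [NormedAddCommGroup V] [InnerProductSpace ℝ V]

/-- The Fourier weight `(1 + ‖2πξ‖²)ˢ` of the Sobolev norm of order `s`. -/
def sobWeight (s : ℝ) (ξ : V) : ℝ := (1 + ‖(2 * Real.pi) • ξ‖ ^ 2) ^ s

theorem sobWeight_pos (s : ℝ) (ξ : V) : 0 < sobWeight s ξ :=
  Real.rpow_pos_of_pos (by positivity) _

theorem one_le_sobWeight {s : ℝ} (hs : 0 ≤ s) (ξ : V) : 1 ≤ sobWeight s ξ :=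
  Real.one_le_rpow (by nlinarith [sq_nonneg ‖(2 * Real.pi) • ξ‖]) hs

theorem sobWeight_add (s t : ℝ) (ξ : V) : sobWeight (s + t) ξ = sobWeight s ξ * sobWeight t ξ :=
  Real.rpow_add (by positivity) _ _

theorem sobWeight_zero (ξ : V) : sobWeight 0 ξ = 1 := Real.rpow_zero _

theorem continuous_sobWeight (s : ℝ) : Continuous (sobWeight s : V → ℝ) := by
  unfold sobWeight
  exact Continuous.rpow_const (by fun_prop) fun ξ => Or.inl (by positivity)

theorem sobWeight_half_mul_self (s : ℝ) (ξ : V) :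
    sobWeight (s / 2) ξ * sobWeight (s / 2) ξ = sobWeight s ξ := by
  rw [← sobWeight_add]; congr 1; ring

theorem sobWeight_neg_mul_self (s : ℝ) (ξ : V) : sobWeight (-s) ξ * sobWeight s ξ = 1 := by
  rw [← sobWeight_add, neg_add_cancel, sobWeight_zero]

variable [FiniteDimensional ℝ V] [MeasurableSpace V] [BorelSpace V]

theorem integrable_sobWeight_neg {s : ℝ} (hs : (Module.finrank ℝ V : ℝ) / 2 < s) :
    Integrable (sobWeight (-s) : V → ℝ) := by
  have h := integrable_rpow_neg_one_add_norm_sq (μ := (volume : Measure V)) (r := 2 * s)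
    (by linarith)
  have h' := h.comp_smul (R := 2 * Real.pi) (by positivity)
  refine h'.congr (Filter.Eventually.of_forall fun ξ => ?_)
  simp only [sobWeight]
  congr 1; ring

variable {F G : Type*} [NormedAddCommGroup F] [NormedAddCommGroup G]

/-- The weighted `L²` norm `(∫ (1 + ‖2πξ‖²)ˢ ‖w(ξ)‖² dξ)^(1/2)`. -/
def sobEnergy (s : ℝ) (w : V → F) : ℝ≥0∞ :=
  (∫⁻ ξ, ENNReal.ofReal (sobWeight s ξ) * ‖w ξ‖ₑ ^ 2) ^ (1 / 2 : ℝ)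

theorem sobEnergy_congr_enorm {s : ℝ} {w : V → F} {v : V → G} (h : ∀ ξ, ‖w ξ‖ₑ = ‖v ξ‖ₑ) :
    sobEnergy s w = sobEnergy s v := by
  simp only [sobEnergy, h]

theorem sobEnergy_congr_ae {s : ℝ} {w v : V → F} (h : w =ᵐ[volume] v) :
    sobEnergy s w = sobEnergy s v := by
  unfold sobEnergy
  congr 1
  apply lintegral_congr_ae
  filter_upwards [h] with ξ hξ
  rw [hξ]

theorem sobEnergy_const_smul [NormedSpace ℝ F] (s c : ℝ) (w : V → F) :
    sobEnergy s (fun ξ => c • w ξ) = ‖c‖ₑ * sobEnergy s w := by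
  unfold sobEnergy
  have : ∀ ξ, ENNReal.ofReal (sobWeight s ξ) * ‖c • w ξ‖ₑ ^ 2 =
      ‖c‖ₑ ^ 2 * (ENNReal.ofReal (sobWeight s ξ) * ‖w ξ‖ₑ ^ 2) := by
    intro ξ; rw [enorm_smul]; ring
  simp_rw [this]
  rw [lintegral_const_mul' _ _ (by simp), ENNReal.mul_rpow_of_nonneg _ _ (by norm_num)]
  congr 1
  rw [← ENNReal.rpow_natCast, ← ENNReal.rpow_mul]
  norm_num

/-- Cauchy–Schwarz after inserting `1 = sobWeight (-s/2) * sobWeight (s/2)`: the duality between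
orders `-s` and `s`. -/
theorem lintegral_enorm_mul_le (s : ℝ) {a : V → F} {w : V → G}
    (ha : AEStronglyMeasurable a) (hw : AEStronglyMeasurable w) :
    ∫⁻ ξ, ‖a ξ‖ₑ * ‖w ξ‖ₑ ≤ sobEnergy (-s) a * sobEnergy s w := by
  have hm : ∀ t : ℝ, AEMeasurable (fun ξ : V => ENNReal.ofReal (sobWeight t ξ)) :=
    fun t => ((continuous_sobWeight t).measurable.ennreal_ofReal).aemeasurable
  have h := ENNReal.lintegral_mul_le_Lp_mul_Lq (volume : Measure V)
    (Real.HolderConjugate.two_two)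
    (f := fun ξ => ENNReal.ofReal (sobWeight (-s / 2) ξ) * ‖a ξ‖ₑ)
    (g := fun ξ => ENNReal.ofReal (sobWeight (s / 2) ξ) * ‖w ξ‖ₑ)
    ((hm _).mul ha.enorm) ((hm _).mul hw.enorm)
  have e : ∀ (t : ℝ) (ξ : V) (b : ℝ≥0∞), (ENNReal.ofReal (sobWeight (t / 2) ξ) * b) ^ (2 : ℝ) =
      ENNReal.ofReal (sobWeight t ξ) * b ^ 2 := by
    intro t ξ b
    rw [ENNReal.rpow_ofNat, mul_pow, sq (ENNReal.ofReal _),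
      ← ENNReal.ofReal_mul (sobWeight_pos _ _).le, sobWeight_half_mul_self]
  simp only [e, Pi.mul_apply] at h
  refine le_trans (lintegral_mono fun ξ => ?_) h
  have : ENNReal.ofReal (sobWeight (-s / 2) ξ) * ENNReal.ofReal (sobWeight (s / 2) ξ) = 1 := by
    rw [← ENNReal.ofReal_mul (sobWeight_pos _ _).le, neg_div, sobWeight_neg_mul_self,
      ENNReal.ofReal_one]
  calc ‖a ξ‖ₑ * ‖w ξ‖ₑ = 1 * (‖a ξ‖ₑ * ‖w ξ‖ₑ) := (one_mul _).symm
    _ ≤ _ := by rw [← this]; apply le_of_eq; ring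

theorem sobEnergy_neg_one_lt_top {s : ℝ} (hs : (Module.finrank ℝ V : ℝ) / 2 < s) :
    sobEnergy (-s) (fun _ : V => (1 : ℝ)) < ∞ := by
  unfold sobEnergy
  apply ENNReal.rpow_lt_top_of_nonneg (by norm_num)
  simpa using! (integrable_sobWeight_neg hs).lintegral_lt_top.ne

/-- The Sobolev embedding: pair `w` with the constant `1`, whose energy of order `-s` is finite
because `s > dim V / 2`. -/
theorem integrable_of_sobEnergy_lt_top {s : ℝ} (hs : (Module.finrank ℝ V : ℝ) / 2 < s) {w : V → F}
    (hw : AEStronglyMeasurable w) (h : sobEnergy s w < ∞) : Integrable w := by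
  refine ⟨hw, ?_⟩
  have := lintegral_enorm_mul_le s (a := fun _ : V => (1 : ℝ)) aestronglyMeasurable_const hw
  simp only [enorm_one, one_mul] at this
  exact this.trans_lt (ENNReal.mul_lt_top (sobEnergy_neg_one_lt_top hs) h)

theorem memLp_of_sobEnergy_lt_top {s : ℝ} (hs : 0 ≤ s) {w : V → F}
    (hw : AEStronglyMeasurable w) (h : sobEnergy s w < ∞) : MemLp w 2 := by
  refine ⟨hw, ?_⟩
  rw [eLpNorm_lt_top_iff_lintegral_rpow_enorm_lt_top (by norm_num) (by norm_num)]
  have h' : ∫⁻ ξ, ENNReal.ofReal (sobWeight s ξ) * ‖w ξ‖ₑ ^ 2 < ∞ := by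
    by_contra hc
    rw [not_lt, top_le_iff] at hc
    rw [sobEnergy, hc, ENNReal.top_rpow_of_pos (by norm_num)] at h
    exact lt_irrefl _ h
  refine lt_of_le_of_lt (lintegral_mono fun ξ => ?_) h'
  simp only [ENNReal.toReal_ofNat, ENNReal.rpow_ofNat]
  calc ‖w ξ‖ₑ ^ 2 = 1 * ‖w ξ‖ₑ ^ 2 := (one_mul _).symm
    _ ≤ _ := by gcongr; exact ENNReal.one_le_ofReal.mpr (one_le_sobWeight hs ξ)

end Energy

/-! ### Real vectors inside complex ones. -/

section Complexify

variable {V : Type*} {m : ℕ}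

/-- A real vector, read as a complex vector. -/
def complexVec : E m →ₗ[ℝ] EuclideanSpace ℂ (Fin m) where
  toFun v := WithLp.toLp 2 fun i => ((v i : ℝ) : ℂ)
  map_add' v w := by ext i; simp
  map_smul' c v := by ext i; simp

theorem complexVec_apply (v : E m) (i : Fin m) : complexVec v i = (v i : ℂ) := rfl

theorem complexify_apply (f : V → E m) (x : V) : complexify f x = complexVec (f x) := rfl

theorem inner_complexVec (v w : E m) :
    inner ℂ (complexVec v) (complexVec w) = (inner ℝ v w : ℂ) := by
  simp [PiLp.inner_apply, complexVec_apply]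

theorem continuous_of_complexify [TopologicalSpace V] {f : V → E m}
    (h : Continuous (complexify f)) : Continuous f := by
  have : f = fun x => WithLp.toLp 2 fun i => (complexify f x i).re := by
    ext x i; simp [complexify]
  rw [this]
  refine (PiLp.continuous_toLp 2 _).comp (continuous_pi fun i => ?_)
  exact Complex.continuous_re.comp ((PiLp.continuous_apply 2 _ i).comp h)

theorem continuous_complexify [TopologicalSpace V] {f : V → E m} (h : Continuous f) :
    Continuous (complexify f) :=
  (PiLp.continuous_toLp 2 _).comp (continuous_pi fun i =>
    Complex.continuous_ofReal.comp ((PiLp.continuous_apply 2 _ i).comp h))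

end Complexify

/-! ### Sobolev functions as inverse Fourier transforms of integrable spectra. -/

section Representation

variable {V : Type*} [NormedAddCommGroup V] [InnerProductSpace ℝ V] [FiniteDimensional ℝ V]
  [MeasurableSpace V] [BorelSpace V] {m : ℕ}

/-- With this, a norm is computed by exhibiting a spectrum `w`; continuity and square integrability
of `u` come for free. -/
theorem sobNorm_eq_of_fourierInv (s : ℝ) {u : V → E m} {w : V → EuclideanSpace ℂ (Fin m)}
    (h1 : Integrable w) (h2 : MemLp w 2) (h : complexify u = 𝓕⁻ w) :
    sobNorm s u = sobEnergy s w := by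
  have hc : Continuous u := continuous_of_complexify (h ▸ continuous_fourierInv h1)
  have hu : MemLp (complexify u) 2 := h ▸ memLp_fourierInv h1 h2
  rw [sobNorm, iInf_pos hc, iInf_pos hu, fourier_toLp_eq h1 h2 hu h]
  exact sobEnergy_congr_ae h2.coeFn_toLp

theorem exists_fourierInv_of_sobNorm_lt_top {s : ℝ} (hs : (Module.finrank ℝ V : ℝ) / 2 < s)
    {u : V → E m} (hu : sobNorm s u < ∞) : ∃ w : V → EuclideanSpace ℂ (Fin m),
      Integrable w ∧ MemLp w 2 ∧ complexify u = 𝓕⁻ w ∧ sobNorm s u = sobEnergy s w := by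
  have hs0 : 0 ≤ s := le_trans (by positivity) hs.le
  simp only [sobNorm, iInf_lt_iff] at hu
  obtain ⟨hc, hu2, hlt⟩ := hu
  set w := (𝓕 (hu2.toLp (complexify u)) : Lp (EuclideanSpace ℂ (Fin m)) 2 (volume : Measure V))
  have hm : AEStronglyMeasurable w := (Lp.memLp w).1
  have h1 : Integrable w := integrable_of_sobEnergy_lt_top hs hm hlt
  have h : complexify u = 𝓕⁻ ⇑w :=
    eq_fourierInv_of_continuous (continuous_complexify hc) hu2 h1 (by rfl)
  exact ⟨w, h1, Lp.memLp w, h, sobNorm_eq_of_fourierInv s h1 (Lp.memLp w) h⟩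

theorem sobNorm_le_of_fourierInv {s : ℝ} (hs : (Module.finrank ℝ V : ℝ) / 2 < s)
    {u : V → E m} {w : V → EuclideanSpace ℂ (Fin m)} (hw : AEStronglyMeasurable w)
    (h : complexify u = 𝓕⁻ w) : sobNorm s u ≤ sobEnergy s w := by
  have hs0 : 0 ≤ s := le_trans (by positivity) hs.le
  rcases eq_or_ne (sobEnergy s w) ∞ with ht | ht
  · rw [ht]; exact le_top
  · exact (sobNorm_eq_of_fourierInv s (integrable_of_sobEnergy_lt_top hs hw ht.lt_top)
      (memLp_of_sobEnergy_lt_top hs0 hw ht.lt_top) h).le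

theorem sobNorm_zero {s : ℝ} : sobNorm s (fun _ : V => (0 : E m)) = 0 := by
  rw [sobNorm_eq_of_fourierInv s (w := fun _ => 0) (integrable_zero _ _ _) MemLp.zero']
  · simp [sobEnergy]
  · ext x i
    simp [complexify, Real.fourierInv_eq]

theorem sobNorm_const_smul_le {s : ℝ} (hs : (Module.finrank ℝ V : ℝ) / 2 < s) {c : ℝ} (hc : c ≠ 0)
    (u : V → E m) : sobNorm s (fun x => c • u x) ≤ ‖c‖ₑ * sobNorm s u := by
  rcases eq_or_ne (sobNorm s u) ∞ with ht | ht
  · rw [ht, ENNReal.mul_top (by simpa using hc)]; exact le_top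
  obtain ⟨w, h1, h2, h, e⟩ := exists_fourierInv_of_sobNorm_lt_top hs ht.lt_top
  rw [e, ← sobEnergy_const_smul]
  apply sobNorm_le_of_fourierInv hs (h1.1.const_smul c)
  ext1 x
  rw [complexify_apply, map_smul, ← complexify_apply, h, Real.fourierInv_eq, Real.fourierInv_eq,
    ← integral_smul]
  exact integral_congr_ae (.of_forall fun ξ => smul_comm _ _ _)

/-- Translation multiplies the spectrum by a unimodular character. -/
theorem sobNorm_comp_add_le {s : ℝ} (hs : (Module.finrank ℝ V : ℝ) / 2 < s) (a : V)
    (u : V → E m) : sobNorm s (fun x => u (x + a)) ≤ sobNorm s u := by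
  rcases eq_or_ne (sobNorm s u) ∞ with ht | ht
  · rw [ht]; exact le_top
  obtain ⟨w, h1, h2, h, e⟩ := exists_fourierInv_of_sobNorm_lt_top hs ht.lt_top
  rw [e, ← sobEnergy_congr_enorm (w := fun ξ => Real.fourierChar (inner ℝ ξ a) • w ξ)]
  · apply sobNorm_le_of_fourierInv hs
    · refine AEStronglyMeasurable.fun_smul (Continuous.aestronglyMeasurable ?_) h1.1
      exact Real.continuous_fourierChar.comp (by fun_prop)
    ext1 x
    rw [complexify_apply, ← complexify_apply, h, Real.fourierInv_eq, Real.fourierInv_eq]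
    congr 1 with ξ
    rw [inner_add_right, AddChar.map_add_eq_mul, mul_smul]
  · intro ξ
    rw [← ofReal_norm, ← ofReal_norm, Circle.norm_smul]

end Representation

/-! ### Kernel sums and the reproducing property. -/

section Kernel

variable {V : Type*} [NormedAddCommGroup V] [InnerProductSpace ℝ V] {n m : ℕ}

theorem re_fourierChar (t : ℝ) : (Real.fourierChar t : ℂ).re = Real.cos (2 * Real.pi * t) := by
  rw [Real.fourierChar_apply, Complex.exp_ofReal_mul_I_re]

theorem im_fourierChar (t : ℝ) : (Real.fourierChar t : ℂ).im = Real.sin (2 * Real.pi * t) := by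
  rw [Real.fourierChar_apply, Complex.exp_ofReal_mul_I_im]

/-- The trigonometric polynomial `∑ᵢ e^{-2πi⟨ξ, xᵢ⟩} vᵢ`. -/
def trigSum (x : Fin n → V) (v : Fin n → E m) (ξ : V) : EuclideanSpace ℂ (Fin m) :=
  ∑ i, Real.fourierChar (-inner ℝ ξ (x i)) • complexVec (v i)

theorem continuous_trigSum (x : Fin n → V) (v : Fin n → E m) : Continuous (trigSum x v) := by
  unfold trigSum
  refine continuous_finsetSum _ fun i _ => ?_
  have h : Continuous fun ξ : V => -inner ℝ ξ (x i) := by fun_prop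
  exact (Real.continuous_fourierChar.comp h).smul continuous_const

theorem inner_fourierChar_smul (t : ℝ) (a b : EuclideanSpace ℂ (Fin m)) :
    inner ℂ (Real.fourierChar (-t) • a) b = (Real.fourierChar t : ℂ) * inner ℂ a b := by
  rw [Circle.smul_def, inner_smul_left, AddChar.map_neg_eq_inv, Circle.coe_inv_eq_conj,
    RingHomCompTriple.comp_apply, RingHom.id_apply]

theorem norm_sq_trigSum (x : Fin n → V) (v : Fin n → E m) (ξ : V) :
    ‖trigSum x v ξ‖ ^ 2 =
      ∑ i, ∑ j, Real.cos (2 * Real.pi * inner ℝ ξ (x i - x j)) * inner ℝ (v i) (v j) := by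
  rw [← inner_self_eq_norm_sq (𝕜 := ℂ), trigSum, sum_inner, map_sum]
  refine Finset.sum_congr rfl fun i _ => ?_
  rw [inner_sum, map_sum]
  refine Finset.sum_congr rfl fun j _ => ?_
  rw [inner_fourierChar_smul, Circle.smul_def, inner_smul_right, ← mul_assoc, ← Circle.coe_mul,
    ← AddChar.map_add_eq_mul, inner_complexVec, inner_sub_right, ← re_fourierChar, sub_eq_add_neg]
  simp

variable [FiniteDimensional ℝ V] [MeasurableSpace V] [BorelSpace V]

theorem integrable_sobWeight_neg_mul_cos {s : ℝ} (hs : (Module.finrank ℝ V : ℝ) / 2 < s) (z : V) :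
    Integrable fun ξ : V => sobWeight (-s) ξ * Real.cos (2 * Real.pi * inner ℝ ξ z) := by
  refine (integrable_sobWeight_neg hs).mul_bdd (c := 1) (by fun_prop) (.of_forall fun ξ => ?_)
  simpa using Real.abs_cos_le_one _

/-- The kernel as an inverse Fourier transform. -/
theorem ofReal_sobKernel {s : ℝ} (hs : (Module.finrank ℝ V : ℝ) / 2 < s) (x y : V) :
    ((sobKernel s x y : ℝ) : ℂ) =
      ∫ ξ : V, (sobWeight (-s) ξ : ℂ) * Real.fourierChar (inner ℝ ξ (x - y)) := by
  set z := x - y with hz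
  have hI : Integrable fun ξ : V => (sobWeight (-s) ξ : ℂ) * Real.fourierChar (inner ℝ ξ z) := by
    refine (integrable_sobWeight_neg hs).ofReal.mul_bdd (c := 1) ?_ (.of_forall fun ξ => ?_)
    · refine Continuous.aestronglyMeasurable (continuous_subtype_val.comp
        (Real.continuous_fourierChar.comp (by fun_prop)))
    · exact (Circle.norm_coe _).le
  apply Complex.ext
  · rw [Complex.ofReal_re]
    have := integral_re hI
    simp only [RCLike.re_to_complex, Complex.re_ofReal_mul, re_fourierChar] at this
    rw [← this]
    rfl
  · rw [Complex.ofReal_im]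
    have := integral_im hI
    simp only [RCLike.im_to_complex, Complex.im_ofReal_mul, im_fourierChar] at this
    rw [← this]
    -- The imaginary part is the integral of an odd function, hence zero.
    have odd := integral_neg_eq_self
      (fun ξ : V => sobWeight (-s) ξ * Real.sin (2 * Real.pi * inner ℝ ξ z)) volume
    simp only [inner_neg_left, mul_neg, Real.sin_neg, sobWeight, smul_neg, norm_neg,
      integral_neg] at odd
    simp only [sobWeight]
    linarith

theorem sobKernel_self_nonneg (s : ℝ) (x : V) : 0 ≤ sobKernel s x x := by
  unfold sobKernel
  apply integral_nonneg
  intro ξ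
  simp
  positivity

/-- The quadratic form `∑ᵢⱼ k_s(xᵢ, xⱼ) ⟨vᵢ, vⱼ⟩`. -/
def gram (s : ℝ) (x : Fin n → V) (v : Fin n → E m) : ℝ :=
  ∑ i, ∑ j, sobKernel s (x i) (x j) * inner ℝ (v i) (v j)

theorem integral_weight_norm_sq_trigSum {s : ℝ} (hs : (Module.finrank ℝ V : ℝ) / 2 < s)
    (x : Fin n → V) (v : Fin n → E m) :
    Integrable (fun ξ => sobWeight (-s) ξ * ‖trigSum x v ξ‖ ^ 2) ∧
      ∫ ξ, sobWeight (-s) ξ * ‖trigSum x v ξ‖ ^ 2 = gram s x v := by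
  have hI : ∀ i j, Integrable fun ξ : V => sobWeight (-s) ξ *
      Real.cos (2 * Real.pi * inner ℝ ξ (x i - x j)) * inner ℝ (v i) (v j) :=
    fun i j => (integrable_sobWeight_neg_mul_cos hs _).mul_const _
  simp only [norm_sq_trigSum, Finset.mul_sum, ← mul_assoc]
  constructor
  · exact integrable_finsetSum _ fun i _ => integrable_finsetSum _ fun j _ => hI i j
  · rw [integral_finsetSum _ fun i _ => integrable_finsetSum _ fun j _ => hI i j]
    refine Finset.sum_congr rfl fun i _ => ?_
    rw [integral_finsetSum _ fun j _ => hI i j]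
    refine Finset.sum_congr rfl fun j _ => ?_
    rw [integral_mul_const]
    rfl

theorem gram_nonneg {s : ℝ} (hs : (Module.finrank ℝ V : ℝ) / 2 < s)
    (x : Fin n → V) (v : Fin n → E m) : 0 ≤ gram s x v := by
  rw [← (integral_weight_norm_sq_trigSum hs x v).2]
  exact integral_nonneg fun ξ => mul_nonneg (sobWeight_pos _ _).le (by positivity)

/-- Evaluation `u ↦ ∑ᵢ ⟨vᵢ, u(xᵢ)⟩` is pairing with `trigSum x v` on the Fourier side, so its size
is measured by the energy of order `-s`. -/
theorem sobEnergy_trigSum {s : ℝ} (hs : (Module.finrank ℝ V : ℝ) / 2 < s)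
    (x : Fin n → V) (v : Fin n → E m) :
    sobEnergy (-s) (trigSum x v) = ENNReal.ofReal √(gram s x v) := by
  obtain ⟨hI, he⟩ := integral_weight_norm_sq_trigSum hs x v
  rw [Real.sqrt_eq_rpow, ← ENNReal.ofReal_rpow_of_nonneg (gram_nonneg hs x v) (by norm_num), ← he,
    ofReal_integral_eq_lintegral_ofReal hI
      (.of_forall fun ξ => mul_nonneg (sobWeight_pos _ _).le (by positivity)), sobEnergy]
  congr 1
  refine lintegral_congr fun ξ => ?_
  rw [ENNReal.ofReal_mul (sobWeight_pos _ _).le, ENNReal.ofReal_pow (norm_nonneg _), ofReal_norm]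

/-- The reproducing property, combined with the Cauchy–Schwarz inequality. -/
theorem enorm_sum_inner_le_sobNorm {s : ℝ} (hs : (Module.finrank ℝ V : ℝ) / 2 < s)
    (x : Fin n → V) (v : Fin n → E m) {u : V → E m} (hu : sobNorm s u < ∞) :
    ‖∑ i, inner ℝ (v i) (u (x i))‖ₑ ≤ ENNReal.ofReal √(gram s x v) * sobNorm s u := by
  obtain ⟨w, h1, h2, h, e⟩ := exists_fourierInv_of_sobNorm_lt_top hs hu
  have hI : ∀ i, Integrable fun ξ => Real.fourierChar (inner ℝ ξ (x i)) • w ξ := fun i => by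
    simpa using (Real.fourierIntegral_convergent_iff (-x i)).mpr h1
  have key : ((∑ i, inner ℝ (v i) (u (x i)) : ℝ) : ℂ) = ∫ ξ, inner ℂ (trigSum x v ξ) (w ξ) := by
    simp only [trigSum, sum_inner]
    rw [integral_finsetSum, Complex.ofReal_sum]
    · refine Finset.sum_congr rfl fun i _ => ?_
      rw [← inner_complexVec, ← complexify_apply u, h, Real.fourierInv_eq, ← integral_inner (hI i)]
      congr 1 with ξ
      rw [inner_fourierChar_smul, Circle.smul_def, inner_smul_right]
    · intro i _
      refine ((hI i).const_inner (𝕜 := ℂ) (complexVec (v i))).congr (.of_forall fun ξ => ?_)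
      simp only
      rw [inner_fourierChar_smul, Circle.smul_def, inner_smul_right]
  have e1 : ‖∑ i, inner ℝ (v i) (u (x i))‖ₑ = ‖∫ ξ, inner ℂ (trigSum x v ξ) (w ξ)‖ₑ := by
    rw [← key, ← ofReal_norm, ← ofReal_norm, Complex.norm_real]
  rw [e1, e, ← sobEnergy_trigSum hs]
  refine (enorm_integral_le_lintegral_enorm _).trans (le_trans (lintegral_mono fun ξ => ?_)
    (lintegral_enorm_mul_le s (continuous_trigSum x v).aestronglyMeasurable h1.1))
  rw [← ofReal_norm, ← ofReal_norm, ← ofReal_norm, ← ENNReal.ofReal_mul (norm_nonneg _)]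
  exact ENNReal.ofReal_le_ofReal (norm_inner_le_norm _ _)

/-- The spectrum of the kernel sum is `sobWeight (-s) • trigSum x v`, and `sobWeight s * sobWeight
(-s) ^ 2 = sobWeight (-s)`. -/
theorem sobNorm_kernel_sum {s : ℝ} (hs : (Module.finrank ℝ V : ℝ) / 2 < s)
    (x : Fin n → V) (v : Fin n → E m) :
    sobNorm s (fun y => ∑ i, sobKernel s y (x i) • v i) = ENNReal.ofReal √(gram s x v) := by
  set w : V → EuclideanSpace ℂ (Fin m) := fun ξ => sobWeight (-s) ξ • trigSum x v ξ with hw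
  have hm : AEStronglyMeasurable w :=
    ((continuous_sobWeight (-s)).smul (continuous_trigSum x v)).aestronglyMeasurable
  have he : sobEnergy s w = ENNReal.ofReal √(gram s x v) := by
    rw [← sobEnergy_trigSum hs, sobEnergy, sobEnergy]
    congr 1
    refine lintegral_congr fun ξ => ?_
    have hp := (sobWeight_pos (-s) ξ).le
    have : ENNReal.ofReal (sobWeight s ξ) * ENNReal.ofReal (sobWeight (-s) ξ) = 1 := by
      rw [mul_comm, ← ENNReal.ofReal_mul hp, sobWeight_neg_mul_self, ENNReal.ofReal_one]
    rw [hw, enorm_smul, Real.enorm_of_nonneg hp]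
    calc _ = (ENNReal.ofReal (sobWeight s ξ) * ENNReal.ofReal (sobWeight (-s) ξ)) *
          (ENNReal.ofReal (sobWeight (-s) ξ) * ‖trigSum x v ξ‖ₑ ^ 2) := by ring
      _ = _ := by rw [this, one_mul]
  have hlt : sobEnergy s w < ∞ := he ▸ ENNReal.ofReal_lt_top
  have hs0 : 0 ≤ s := le_trans (by positivity) hs.le
  rw [← he]
  refine sobNorm_eq_of_fourierInv s (integrable_of_sobEnergy_lt_top hs hm hlt)
    (memLp_of_sobEnergy_lt_top hs0 hm hlt) ?_
  ext1 y
  have hI : ∀ i, Integrable fun ξ : V =>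
      ((sobWeight (-s) ξ : ℂ) * Real.fourierChar (inner ℝ ξ (y - x i))) • complexVec (v i) := by
    intro i
    refine Integrable.smul_const ?_ _
    refine (integrable_sobWeight_neg hs).ofReal.mul_bdd (c := 1) ?_ (.of_forall fun ξ => ?_)
    · refine Continuous.aestronglyMeasurable (continuous_subtype_val.comp
        (Real.continuous_fourierChar.comp (by fun_prop)))
    · exact (Circle.norm_coe _).le
  rw [complexify_apply, map_sum, Real.fourierInv_eq]
  have : ∀ ξ, Real.fourierChar (inner ℝ ξ y) • w ξ =
      ∑ i, ((sobWeight (-s) ξ : ℂ) * Real.fourierChar (inner ℝ ξ (y - x i))) •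
        complexVec (v i) := by
    intro ξ
    simp only [hw, trigSum, Finset.smul_sum]
    refine Finset.sum_congr rfl fun i _ => ?_
    rw [inner_sub_right, sub_eq_add_neg, AddChar.map_add_eq_mul, Circle.coe_mul, Circle.smul_def,
      Circle.smul_def, ← Complex.coe_smul, smul_smul, smul_smul]
    congr 1
    ring
  simp_rw [this]
  rw [integral_finsetSum _ fun i _ => hI i]
  refine Finset.sum_congr rfl fun i _ => ?_
  rw [integral_smul_const, ← ofReal_sobKernel hs, map_smul, Complex.coe_smul]

end Kernel

/-! ### Composition with an injective matrix. -/

section LinearChange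

variable {V : Type*} [NormedAddCommGroup V] [InnerProductSpace ℝ V] [FiniteDimensional ℝ V]
  [MeasurableSpace V] [BorelSpace V] {m p q : ℕ}

theorem det_toEuclideanLin (N : Matrix (Fin p) (Fin p) ℝ) :
    LinearMap.det (Matrix.toEuclideanLin N) = N.det := by
  change LinearMap.det (Matrix.toLpLin 2 2 N) = N.det
  rw [Matrix.toLpLin_eq_toLin, LinearMap.det_toLin]

theorem det_adjoint_pair (S S' : E p →ₗ[ℝ] E p) (h : ∀ x y, inner ℝ (S x) y = inner ℝ x (S' y)) :
    LinearMap.det S' = LinearMap.det S := by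
  obtain ⟨N, rfl⟩ := (Matrix.toEuclideanLin (𝕜 := ℝ) (m := Fin p) (n := Fin p)).surjective S
  have : S' = Matrix.toEuclideanLin N.transpose := by
    rw [← Matrix.conjTranspose_eq_transpose_of_trivial,
      Matrix.toEuclideanLin_conjTranspose_eq_adjoint]
    refine LinearMap.ext fun y => ext_inner_left ℝ fun x => ?_
    rw [← h, LinearMap.adjoint_inner_right]
  rw [this, det_toEuclideanLin, det_toEuclideanLin, Matrix.det_transpose]

/-- Behaviour of Lebesgue measure under the transpose `T` of a linear isomorphism `B`. -/
theorem map_transpose_volume (B : E p ≃ₗ[ℝ] V) (T : V ≃ₗ[ℝ] E p)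
    (hT : ∀ x η, inner ℝ (B x) η = inner ℝ x (T η)) :
    0 < LinearMap.det (T.toLinearMap ∘ₗ B.toLinearMap) ∧
    Measure.map T (volume : Measure V) =
      ENNReal.ofReal (LinearMap.det (T.toLinearMap ∘ₗ B.toLinearMap) ^ (-(1 / 2) : ℝ)) •
        (volume : Measure (E p)) := by
  have hfin : Module.finrank ℝ V = p := by rw [← B.finrank_eq]; simp
  -- Orthonormal coordinates on `V` turn `T` and `B` into endomorphisms `S` and `S'` of `ℝᵖ` that
  -- are adjoint to each other, so `det (T B) = (det S)²`; this explains the exponent `-1/2`.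
  set e : V ≃ₗᵢ[ℝ] E p := ((stdOrthonormalBasis ℝ V).reindex (finCongr hfin)).repr
  set S : E p →ₗ[ℝ] E p := T.toLinearMap ∘ₗ e.symm.toLinearEquiv.toLinearMap with hS
  set S' : E p →ₗ[ℝ] E p := e.toLinearEquiv.toLinearMap ∘ₗ B.toLinearMap with hS'
  have hdet : LinearMap.det S' = LinearMap.det S := by
    symm
    apply det_adjoint_pair
    intro x y
    simp only [hS, hS', LinearMap.comp_apply, LinearEquiv.coe_coe,
      LinearIsometryEquiv.coe_toLinearEquiv]
    rw [← hT, ← e.inner_map_map (B x) (e.symm y), e.apply_symm_apply]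
  have hTB : T.toLinearMap ∘ₗ B.toLinearMap = S ∘ₗ S' := by
    ext1 x
    simp [hS, hS']
  have hd : LinearMap.det (T.toLinearMap ∘ₗ B.toLinearMap) = LinearMap.det S ^ 2 := by
    rw [hTB, LinearMap.det_comp, hdet, sq]
  have hne : LinearMap.det S ≠ 0 := by
    have : S = (e.symm.toLinearEquiv.trans T).toLinearMap := rfl
    rw [this]
    exact (LinearEquiv.isUnit_det' _).ne_zero
  refine ⟨hd ▸ by positivity, ?_⟩
  have h1 := Measure.map_linearMap_addHaar_eq_smul_addHaar (μ := (volume : Measure (E p))) hne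
  have h2 : (T : V → E p) = S ∘ e := by
    ext1 x
    simp [hS]
  have hSm : Measurable S := S.continuous_of_finiteDimensional.measurable
  rw [h2, ← Measure.map_map hSm e.continuous.measurable, e.measurePreserving.map_eq, h1, hd]
  congr 2
  rw [← sq_abs, ← Real.rpow_natCast, ← Real.rpow_mul (abs_nonneg _), abs_inv]
  norm_num [Real.rpow_neg_one]

/-- If `u` has spectrum `w`, then `u ∘ B` has spectrum `c • w ∘ T⁻¹` with `c = δ^{-1/2}`. The
squared energy gains `c²` from the scalar and loses one `c` in substituting `ω = T η`; the square
root of what remains is `δ^{-1/4}`. -/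
theorem sobNorm_comp_linearEquiv_le {s : ℝ} (hs : (Module.finrank ℝ V : ℝ) / 2 < s)
    (B : E p ≃ₗ[ℝ] V) (T : V ≃ₗ[ℝ] E p) (hT : ∀ x η, inner ℝ (B x) η = inner ℝ x (T η))
    (r : ℝ≥0∞) (hr : ∀ η, ENNReal.ofReal (sobWeight s (T η)) ≤
      r ^ 2 * ENNReal.ofReal (sobWeight s η)) (u : V → E m) :
    sobNorm s (fun x => u (B x)) ≤
      r * (ENNReal.ofReal (LinearMap.det (T.toLinearMap ∘ₗ B.toLinearMap) ^ (1 / 4 : ℝ)))⁻¹ *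
        sobNorm s u := by
  obtain ⟨hdpos, hmap⟩ := map_transpose_volume B T hT
  set δ := LinearMap.det (T.toLinearMap ∘ₗ B.toLinearMap) with hδ
  -- At frequency `0` both weights are `1`. Without `r ≠ 0`, the case `sobNorm s u = ∞` would meet
  -- `0 * ∞ = 0`.
  have hr0 : r ≠ 0 := by
    rintro rfl
    have := hr 0
    simp [sobWeight] at this
  rcases eq_or_ne (sobNorm s u) ∞ with ht | ht
  · rw [ht, ENNReal.mul_top]
    · exact le_top
    · exact mul_ne_zero hr0 (ENNReal.inv_ne_zero.mpr ENNReal.ofReal_ne_top)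
  obtain ⟨w, h1, h2, h, e⟩ := exists_fourierInv_of_sobNorm_lt_top hs ht.lt_top
  set c : ℝ := δ ^ (-(1 / 2) : ℝ) with hc
  have hcpos : 0 < c := Real.rpow_pos_of_pos hdpos _
  have hTemb : MeasurableEmbedding (T : V → E p) :=
    T.toContinuousLinearEquiv.toHomeomorph.measurableEmbedding
  have hfin : Module.finrank ℝ (E p) = Module.finrank ℝ V := B.finrank_eq
  have hqm : AEStronglyMeasurable (fun ω => w (T.symm ω)) (volume : Measure (E p)) := by
    have : AEStronglyMeasurable (fun ω => w (T.symm ω)) (Measure.map T (volume : Measure V)) := by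
      rw [hTemb.aestronglyMeasurable_map_iff]
      simpa [Function.comp_def] using h1.1
    rw [hmap] at this
    refine this.mono_ac (Measure.absolutelyContinuous_smul ?_)
    simpa using hcpos
  have hrep : complexify (fun x => u (B x)) = 𝓕⁻ (fun ω => c • w (T.symm ω)) := by
    ext1 x
    have h3 : complexify (fun x => u (B x)) x = complexify u (B x) := rfl
    rw [h3, h, Real.fourierInv_eq, Real.fourierInv_eq]
    have h4 := hTemb.integral_map (μ := (volume : Measure V))
      (fun ω => Real.fourierChar (inner ℝ ω x) • w (T.symm ω))
    rw [hmap, integral_smul_measure, ENNReal.toReal_ofReal hcpos.le, ← integral_smul] at h4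
    calc _ = ∫ η, Real.fourierChar (inner ℝ (T η) x) • w (T.symm (T η)) := by
          congr 1 with η
          rw [real_inner_comm (B x) η, real_inner_comm x (T η), hT, T.symm_apply_apply]
      _ = _ := by
          rw [← h4]
          exact integral_congr_ae (.of_forall fun ω => smul_comm _ _ _)
  refine (sobNorm_le_of_fourierInv (hfin ▸ hs) (hqm.const_smul c) hrep).trans ?_
  rw [e]
  unfold sobEnergy
  have h5 : ∫⁻ ω : E p, ENNReal.ofReal (sobWeight s ω) * ‖c • w (T.symm ω)‖ₑ ^ 2 ≤
      r ^ 2 * ENNReal.ofReal c * ∫⁻ η, ENNReal.ofReal (sobWeight s η) * ‖w η‖ₑ ^ 2 := by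
    have h6 := hTemb.lintegral_map (μ := (volume : Measure V))
      (fun ω => ENNReal.ofReal (sobWeight s ω) * ‖w (T.symm ω)‖ₑ ^ 2)
    rw [hmap, lintegral_smul_measure, smul_eq_mul] at h6
    simp only [T.symm_apply_apply] at h6
    calc _ = ENNReal.ofReal c * (ENNReal.ofReal c *
          ∫⁻ ω : E p, ENNReal.ofReal (sobWeight s ω) * ‖w (T.symm ω)‖ₑ ^ 2) := by
          rw [← lintegral_const_mul' _ _ ENNReal.ofReal_ne_top,
            ← lintegral_const_mul' _ _ ENNReal.ofReal_ne_top]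
          refine lintegral_congr fun ω => ?_
          rw [enorm_smul, Real.enorm_of_nonneg hcpos.le]
          ring
      _ = ENNReal.ofReal c *
          ∫⁻ η, ENNReal.ofReal (sobWeight s (T η)) * ‖w η‖ₑ ^ 2 := by rw [h6]
      _ ≤ ENNReal.ofReal c *
          ∫⁻ η, r ^ 2 * (ENNReal.ofReal (sobWeight s η) * ‖w η‖ₑ ^ 2) := by
          refine mul_le_mul_right (lintegral_mono fun η => ?_) _
          rw [← mul_assoc]
          exact mul_le_mul_left (hr η) _
      _ ≤ ENNReal.ofReal c *
          (r ^ 2 * ∫⁻ η, ENNReal.ofReal (sobWeight s η) * ‖w η‖ₑ ^ 2) := by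
          gcongr
          rw [lintegral_const_mul'']
          refine AEMeasurable.mul ?_ (h1.1.enorm.pow_const 2)
          exact (continuous_sobWeight s).measurable.ennreal_ofReal.aemeasurable
      _ = _ := by ring
  refine (ENNReal.rpow_le_rpow h5 (by norm_num)).trans ?_
  rw [ENNReal.mul_rpow_of_nonneg _ _ (by norm_num), ENNReal.mul_rpow_of_nonneg _ _ (by norm_num)]
  gcongr
  · rw [← ENNReal.rpow_natCast, ← ENNReal.rpow_mul]
    norm_num
  · rw [ENNReal.ofReal_rpow_of_pos hcpos, hc, ← Real.rpow_mul hdpos.le,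
      ← ENNReal.ofReal_inv_of_pos (Real.rpow_pos_of_pos hdpos _), ← Real.rpow_neg hdpos.le]
    norm_num

theorem det_pos_of_mem_weightSet {C D : ℝ} (hD : 0 < D) {W : Matrix (Fin q) (Fin p) ℝ}
    (hW : W ∈ weightSet C D p q) : 0 < (W.transpose * W).det := by
  have h0 : 0 ≤ (W.transpose * W).det := by
    have := (Matrix.posSemidef_conjTranspose_mul_self W).det_nonneg
    rwa [Matrix.conjTranspose_eq_transpose_of_trivial] at this
  refine lt_of_le_of_ne h0 fun h => ?_
  have := hW.2.2
  rw [← h, Real.zero_rpow (by norm_num)] at this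
  linarith

theorem toEuclideanLin_transpose_inner (W : Matrix (Fin q) (Fin p) ℝ) (x : E p) (η : E q) :
    inner ℝ (Matrix.toEuclideanLin W x) η = inner ℝ x (Matrix.toEuclideanLin W.transpose η) := by
  rw [← Matrix.conjTranspose_eq_transpose_of_trivial,
    Matrix.toEuclideanLin_conjTranspose_eq_adjoint, LinearMap.adjoint_inner_right]

theorem injective_of_det_pos {W : Matrix (Fin q) (Fin p) ℝ} (h : 0 < (W.transpose * W).det) :
    Function.Injective (Matrix.toEuclideanLin W) := by
  rw [← LinearMap.ker_eq_bot, LinearMap.ker_eq_bot']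
  intro x hx
  have h1 : W.mulVec x.ofLp = 0 := by
    rw [← Matrix.toLin'_apply, ← Matrix.ofLp_toLpLin 2 2, hx]; rfl
  have h2 : (W.transpose * W).mulVec x.ofLp = 0 := by
    rw [← Matrix.mulVec_mulVec, h1, Matrix.mulVec_zero]
  have h3 := Matrix.eq_zero_of_mulVec_eq_zero h.ne' h2
  ext i
  exact congrFun h3 i

theorem sobNorm_comp_matrix_le {s : ℝ} (hs : (p : ℝ) / 2 < s) {W : Matrix (Fin q) (Fin p) ℝ}
    (h : 0 < (W.transpose * W).det)
    (u : LinearMap.range (Matrix.toEuclideanLin W) → E m) :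
    sobNorm s (fun x => u ((Matrix.toEuclideanLin W).rangeRestrict x)) ≤
      fourierRatio s W * (ENNReal.ofReal ((W.transpose * W).det ^ (1 / 4 : ℝ)))⁻¹ *
        sobNorm s u := by
  have hinj : Function.Injective (Matrix.toEuclideanLin W) := injective_of_det_pos h
  -- `B` is `W` onto its range and `T` is `Wᵀ` restricted to that range, so that `T B = WᵀW`.
  let B : E p ≃ₗ[ℝ] LinearMap.range (Matrix.toEuclideanLin W) :=
    LinearEquiv.ofInjective (Matrix.toEuclideanLin W) hinj
  let T₀ : LinearMap.range (Matrix.toEuclideanLin W) →ₗ[ℝ] E p :=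
    Matrix.toEuclideanLin W.transpose ∘ₗ (LinearMap.range (Matrix.toEuclideanLin W)).subtype
  have hT₀ : ∀ x η, inner ℝ (B x) η = inner ℝ x (T₀ η) :=
    fun x η => toEuclideanLin_transpose_inner W x η
  have hT₀inj : Function.Injective T₀ := by
    rw [← LinearMap.ker_eq_bot, LinearMap.ker_eq_bot']
    intro η hη
    obtain ⟨x, rfl⟩ := B.surjective η
    rw [← inner_self_eq_zero (𝕜 := ℝ), hT₀, hη, inner_zero_right]
  let T : LinearMap.range (Matrix.toEuclideanLin W) ≃ₗ[ℝ] E p :=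
    LinearEquiv.ofInjectiveOfFinrankEq T₀ hT₀inj B.finrank_eq.symm
  have hfin : Module.finrank ℝ (LinearMap.range (Matrix.toEuclideanLin W)) = p := by
    rw [← B.finrank_eq]; simp
  have hdet : LinearMap.det (T.toLinearMap ∘ₗ B.toLinearMap) = (W.transpose * W).det := by
    have : T.toLinearMap ∘ₗ B.toLinearMap = Matrix.toEuclideanLin (W.transpose * W) := by
      ext x i
      change Matrix.toEuclideanLin W.transpose (Matrix.toEuclideanLin W x) i = _
      simp [Matrix.toLpLin_apply]
    rw [this, det_toEuclideanLin]
  have key := sobNorm_comp_linearEquiv_le (m := m) (s := s) (by rwa [hfin]) B T hT₀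
    (fourierRatio s W) ?_ u
  · rwa [hdet] at key
  · intro η
    -- `fourierRatio` uses the frequency without the factor `2π`; the range is a subspace, so
    -- rescaling stays inside it.
    set ω : E q := (2 * Real.pi) • (η : E q) with hω
    have hTω : (2 * Real.pi) • T η = Matrix.toEuclideanLin W.transpose ω := by
      rw [hω, map_smul]; rfl
    have hle : ENNReal.ofReal (|(1 + ‖Matrix.toEuclideanLin W.transpose ω‖ ^ 2) /
        (1 + ‖ω‖ ^ 2)| ^ (s / 2)) ≤ fourierRatio s W :=
      le_iSup₂_of_le ω ((LinearMap.range (Matrix.toEuclideanLin W)).smul_mem _ η.2) le_rfl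
    have hsplit : sobWeight s (T η) = (|(1 + ‖Matrix.toEuclideanLin W.transpose ω‖ ^ 2) /
        (1 + ‖ω‖ ^ 2)| ^ (s / 2)) ^ 2 * sobWeight s η := by
      have e1 : sobWeight s η = (1 + ‖ω‖ ^ 2) ^ s := rfl
      rw [e1, sobWeight, hTω, ← Real.rpow_natCast (_ ^ (s / 2)), ← Real.rpow_mul (abs_nonneg _),
        abs_of_nonneg (by positivity), Real.div_rpow (by positivity) (by positivity)]
      have : (1 + ‖ω‖ ^ 2) ^ s ≠ 0 := by positivity
      norm_num
      field_simp
    rw [hsplit, ENNReal.ofReal_mul (by positivity), ENNReal.ofReal_pow (by positivity)]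
    gcongr

end LinearChange

/-! ### The square root of `M`. -/

section SquareRoot

variable {m : ℕ} {M : Matrix (Fin m) (Fin m) ℝ}

theorem inner_toEuclideanLin_sqrt (M : Matrix (Fin m) (Fin m) ℝ) (v w : E m) :
    inner ℝ v (Matrix.toEuclideanLin (CFC.sqrt M) w) =
      inner ℝ (Matrix.toEuclideanLin (CFC.sqrt M) v) w := by
  have h : (CFC.sqrt M).transpose = CFC.sqrt M := by
    have := (Matrix.nonneg_iff_posSemidef.mp (CFC.sqrt_nonneg M)).isHermitian
    rwa [Matrix.IsHermitian, Matrix.conjTranspose_eq_transpose_of_trivial] at this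
  rw [toEuclideanLin_transpose_inner, h]

theorem toEuclideanLin_sqrt_sqrt (hM : M.PosSemidef) (v : E m) :
    Matrix.toEuclideanLin (CFC.sqrt M) (Matrix.toEuclideanLin (CFC.sqrt M) v) =
      Matrix.toEuclideanLin M v := by
  have h := CFC.sqrt_mul_sqrt_self M (Matrix.nonneg_iff_posSemidef.mpr hM)
  conv_rhs => rw [← h]
  ext i
  simp [Matrix.toLpLin_apply]

end SquareRoot

/-! ### The vector-valued space with kernel `k_s M`. -/

section Rkhs

variable {V V' : Type*} [NormedAddCommGroup V] [InnerProductSpace ℝ V] [FiniteDimensional ℝ V]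
  [MeasurableSpace V] [BorelSpace V] [NormedAddCommGroup V'] [InnerProductSpace ℝ V']
  [FiniteDimensional ℝ V'] [MeasurableSpace V'] [BorelSpace V'] {n m : ℕ} {s s' : ℝ}
  {M : Matrix (Fin m) (Fin m) ℝ}

/-- The quadratic form `∑ᵢⱼ k_s(xᵢ, xⱼ) ⟨M vᵢ, vⱼ⟩`. -/
def kernelGram (s : ℝ) (M : Matrix (Fin m) (Fin m) ℝ) (x : Fin n → V) (v : Fin n → E m) : ℝ :=
  gram s x fun i => Matrix.toEuclideanLin (CFC.sqrt M) (v i)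

/-- For `f = √M u`, the symmetric factor `√M` moves onto the vectors `vᵢ`; the scalar-kernel bound
applies to every such `u`, and the infimum over `u` follows. -/
theorem enorm_sum_inner_le_rkhsNorm (hs : (Module.finrank ℝ V : ℝ) / 2 < s) (x : Fin n → V)
    (v : Fin n → E m) {f : V → E m} (hf : rkhsNorm s M f < ∞) :
    ‖∑ i, inner ℝ (v i) (f (x i))‖ₑ ≤
      ENNReal.ofReal √(kernelGram s M x v) * rkhsNorm s M f := by
  by_contra! hlt
  set c := ENNReal.ofReal √(kernelGram s M x v) with hc
  have hex : ∃ u : V → E m, (f = fun x => Matrix.toEuclideanLin (CFC.sqrt M) (u x)) ∧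
      sobNorm s u < ∞ ∧ c * sobNorm s u < ‖∑ i, inner ℝ (v i) (f (x i))‖ₑ := by
    -- A nearly optimal `u` is found by dividing by `c`; when `c = 0`, any `u` of finite norm
    -- serves.
    rcases eq_or_ne c 0 with h0 | h0
    · simp only [rkhsNorm, iInf_lt_iff] at hf
      obtain ⟨u, hu, hlt'⟩ := hf
      refine ⟨u, hu, hlt', ?_⟩
      rw [h0, zero_mul] at hlt ⊢
      exact hlt
    · have ht : c ≠ ∞ := ENNReal.ofReal_ne_top
      rw [mul_comm, ← ENNReal.lt_div_iff_mul_lt (.inl h0) (.inl ht)] at hlt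
      simp only [rkhsNorm, iInf_lt_iff] at hlt
      obtain ⟨u, hu, hlt'⟩ := hlt
      refine ⟨u, hu, hlt'.trans_le le_top, ?_⟩
      rw [mul_comm, ← ENNReal.lt_div_iff_mul_lt (.inl h0) (.inl ht)]
      exact hlt'
  obtain ⟨u, rfl, hu, hlt'⟩ := hex
  refine absurd hlt' (not_lt.mpr ?_)
  simp only [inner_toEuclideanLin_sqrt]
  exact enorm_sum_inner_le_sobNorm hs x _ hu

/-- The reproducing bound at the single point `y` with vector `f y` gives `‖f y‖² ≤ 0`. This settles
the degenerate products `∞ * 0` and quotients by `0` below. -/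
theorem eq_zero_of_rkhsNorm_eq_zero (hs : (Module.finrank ℝ V : ℝ) / 2 < s) {f : V → E m}
    (hf : rkhsNorm s M f = 0) : f = 0 := by
  ext1 y
  have h := enorm_sum_inner_le_rkhsNorm (n := 1) hs (fun _ => y) (fun _ => f y) (f := f) (M := M)
    (by rw [hf]; exact ENNReal.zero_lt_top)
  rw [hf, mul_zero, nonpos_iff_eq_zero, enorm_eq_zero] at h
  simpa using h

theorem rkhsNorm_zero : rkhsNorm s M (0 : V → E m) = 0 := by
  refine nonpos_iff_eq_zero.mp (iInf₂_le_of_le (fun _ => 0) ?_ sobNorm_zero.le)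
  ext1 y
  simp

/-- `√M` acts on values and `φ` on arguments, so the two commute and a Sobolev bound passes to the
quotient norm. -/
theorem rkhsNorm_comp_le (hs : (Module.finrank ℝ V : ℝ) / 2 < s) {c : ℝ≥0∞} (hc : c ≠ 0)
    (φ : V' → V) (h : ∀ u : V → E m, sobNorm s' (fun x => u (φ x)) ≤ c * sobNorm s u)
    (f : V → E m) : rkhsNorm s' M (fun x => f (φ x)) ≤ c * rkhsNorm s M f := by
  rcases eq_or_ne (rkhsNorm s M f) 0 with h0 | h0
  · rw [eq_zero_of_rkhsNorm_eq_zero hs h0]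
    exact (rkhsNorm_zero (V := V')).le.trans zero_le
  · conv_rhs => rw [rkhsNorm]
    rcases eq_or_ne c ∞ with ht | ht
    · rw [← rkhsNorm, ht, ENNReal.top_mul h0]
      exact le_top
    rw [ENNReal.mul_iInf_of_ne hc ht]
    refine le_iInf fun u => ?_
    rw [ENNReal.mul_iInf_of_ne hc ht]
    refine le_iInf fun hu => ?_
    refine (iInf₂_le (fun x => u (φ x)) ?_).trans (h u)
    rw [hu]

theorem rkhsNorm_comp_add_le (hs : (Module.finrank ℝ V : ℝ) / 2 < s) (a : V) (f : V → E m) :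
    rkhsNorm s M (fun x => f (x + a)) ≤ rkhsNorm s M f := by
  have := rkhsNorm_comp_le (M := M) hs one_ne_zero (fun x => x + a)
    (fun u => (sobNorm_comp_add_le hs a u).trans (one_mul _).ge) f
  rwa [one_mul] at this

theorem rkhsNorm_const_smul_le (hs : (Module.finrank ℝ V : ℝ) / 2 < s) {c : ℝ} (hc : c ≠ 0)
    (f : V → E m) : rkhsNorm s M (fun x => c • f x) ≤ ‖c‖ₑ * rkhsNorm s M f := by
  have hc' : ‖c‖ₑ ≠ 0 := by simpa using hc
  conv_rhs => rw [rkhsNorm]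
  rw [ENNReal.mul_iInf_of_ne hc' enorm_ne_top]
  refine le_iInf fun u => ?_
  rw [ENNReal.mul_iInf_of_ne hc' enorm_ne_top]
  refine le_iInf fun hu => ?_
  refine (iInf₂_le (fun x => c • u x) ?_).trans (sobNorm_const_smul_le hs hc u)
  simp [hu]

theorem rkhsNorm_comp_le_koopmanNorm (hs : (Module.finrank ℝ V : ℝ) / 2 < s) (σ : V → V)
    {f : V → E m} (hf : rkhsNorm s M f < ∞) :
    rkhsNorm s M (fun x => f (σ x)) ≤ koopmanNorm s M σ * rkhsNorm s M f := by
  rcases eq_or_ne (rkhsNorm s M f) 0 with h0 | h0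
  · rw [eq_zero_of_rkhsNorm_eq_zero hs h0]
    exact (rkhsNorm_zero (V := V)).le.trans zero_le
  set r := (rkhsNorm s M f).toReal with hr
  have hrpos : 0 < r := ENNReal.toReal_pos h0 hf.ne
  have hre : ‖r‖ₑ = rkhsNorm s M f := by
    rw [Real.enorm_of_nonneg hrpos.le, hr, ENNReal.ofReal_toReal hf.ne]
  have h1 : rkhsNorm s M (fun x => r⁻¹ • f x) ≤ 1 := by
    refine (rkhsNorm_const_smul_le hs (inv_ne_zero hrpos.ne') f).trans ?_
    rw [← hre, ← enorm_mul, inv_mul_cancel₀ hrpos.ne', enorm_one]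
  have h2 := rkhsNorm_const_smul_le (M := M) hs hrpos.ne' (fun x => r⁻¹ • f (σ x))
  simp only [smul_inv_smul₀ hrpos.ne'] at h2
  refine h2.trans ?_
  rw [hre, mul_comm]
  gcongr
  exact le_iSup₂_of_le (f := fun (f : V → E m) (_ : rkhsNorm s M f ≤ 1) =>
    rkhsNorm s M (fun x => f (σ x))) _ h1 le_rfl

theorem sum_inner_kernelSum (hM : M.PosSemidef) (x : Fin n → V) (ε : Signs n m) :
    ∑ i, inner ℝ (signVec ε i) (kernelSum s M x ε (x i)) = kernelGram s M x (signVec ε) := by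
  simp only [kernelGram, gram, kernelSum, inner_sum, inner_smul_right,
    ← toEuclideanLin_sqrt_sqrt hM, inner_toEuclideanLin_sqrt]

theorem kernelGram_nonneg (hs : (Module.finrank ℝ V : ℝ) / 2 < s) (x : Fin n → V)
    (v : Fin n → E m) : 0 ≤ kernelGram s M x v := gram_nonneg hs x _

theorem rkhsNorm_kernelSum (hs : (Module.finrank ℝ V : ℝ) / 2 < s) (hM : M.PosSemidef)
    (x : Fin n → V) (ε : Signs n m) :
    rkhsNorm s M (kernelSum s M x ε) = ENNReal.ofReal √(kernelGram s M x (signVec ε)) := by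
  set Q := kernelGram s M x (signVec ε) with hQ
  have hQ0 : 0 ≤ Q := kernelGram_nonneg hs x _
  have hle : rkhsNorm s M (kernelSum s M x ε) ≤ ENNReal.ofReal √Q := by
    refine iInf₂_le_of_le (fun y => ∑ i, sobKernel s y (x i) •
      Matrix.toEuclideanLin (CFC.sqrt M) (signVec ε i)) ?_ (sobNorm_kernel_sum hs x _).le
    ext1 y
    simp only [kernelSum, map_sum, map_smul, toEuclideanLin_sqrt_sqrt hM]
  refine le_antisymm hle ?_
  -- Lower bound: testing the kernel sum against itself gives `Q ≤ √Q * ‖kernelSum‖`.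
  have h := enorm_sum_inner_le_rkhsNorm hs x (signVec ε) (hle.trans_lt ENNReal.ofReal_lt_top)
  rw [sum_inner_kernelSum hM, ← hQ, Real.enorm_of_nonneg hQ0] at h
  rcases eq_or_ne Q 0 with h0 | h0
  · simp [h0]
  have hpos : 0 < √Q := Real.sqrt_pos.mpr (lt_of_le_of_ne hQ0 (Ne.symm h0))
  conv_lhs at h => rw [← Real.mul_self_sqrt hQ0, ENNReal.ofReal_mul hpos.le]
  exact (ENNReal.mul_le_mul_iff_right (by simpa using hpos) ENNReal.ofReal_ne_top).mp h

theorem rkhsNorm_comp_matrix_le {p q : ℕ} (hs : (p : ℝ) / 2 < s) {W : Matrix (Fin q) (Fin p) ℝ}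
    (h : 0 < (W.transpose * W).det) (f : E q → E m) :
    rkhsNorm s M (fun x => f (Matrix.toEuclideanLin W x)) ≤
      fourierRatio s W * (ENNReal.ofReal ((W.transpose * W).det ^ (1 / 4 : ℝ)))⁻¹ *
        rkhsNorm s M (fun y : LinearMap.range (Matrix.toEuclideanLin W) => f y) := by
  have hfin : Module.finrank ℝ (LinearMap.range (Matrix.toEuclideanLin W)) = p := by
    rw [LinearMap.finrank_range_of_inj (injective_of_det_pos h)]; simp
  refine rkhsNorm_comp_le (V := LinearMap.range (Matrix.toEuclideanLin W)) (by rwa [hfin]) ?_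
    (Matrix.toEuclideanLin W).rangeRestrict (sobNorm_comp_matrix_le hs h) (fun y => f y)
  refine mul_ne_zero ?_ (ENNReal.inv_ne_zero.mpr ENNReal.ofReal_ne_top)
  -- The frequency `ω = 0` contributes `1` to the supremum.
  refine (lt_of_lt_of_le ?_ (le_iSup₂_of_le 0 (Submodule.zero_mem _) le_rfl)).ne'
  simp

end Rkhs

/-! ### Averages over the signs. -/

section Expectation

variable {n m : ℕ}

theorem expect_mono {φ ψ : Signs n m → ℝ≥0∞} (h : ∀ ε, φ ε ≤ ψ ε) : expect φ ≤ expect ψ :=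
  ENNReal.div_le_div_right (Finset.sum_le_sum fun ε _ => h ε) _

theorem expect_add (φ ψ : Signs n m → ℝ≥0∞) :
    expect (fun ε => φ ε + ψ ε) = expect φ + expect ψ := by
  simp only [expect, Finset.sum_add_distrib, ENNReal.add_div]

theorem expect_const_mul (c : ℝ≥0∞) (φ : Signs n m → ℝ≥0∞) :
    expect (fun ε => c * φ ε) = c * expect φ := by
  simp only [expect, ← Finset.mul_sum, mul_div_assoc]

theorem expect_mul_le (φ ψ : Signs n m → ℝ≥0∞) :
    expect (fun ε => φ ε ^ (1 / 2 : ℝ) * ψ ε ^ (1 / 2 : ℝ)) ≤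
      expect φ ^ (1 / 2 : ℝ) * expect ψ ^ (1 / 2 : ℝ) := by
  have h := ENNReal.inner_le_Lp_mul_Lq Finset.univ (fun ε => φ ε ^ (1 / 2 : ℝ))
    (fun ε => ψ ε ^ (1 / 2 : ℝ)) Real.HolderConjugate.two_two
  simp only [← ENNReal.rpow_mul] at h
  norm_num at h
  simp only [expect]
  set N : ℝ≥0∞ := (Fintype.card (Signs n m) : ℝ≥0∞)
  -- The normalisation is shared equally between the two factors of Cauchy–Schwarz.
  have hN : N⁻¹ = N⁻¹ ^ (1 / 2 : ℝ) * N⁻¹ ^ (1 / 2 : ℝ) := by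
    rw [← ENNReal.rpow_add_of_nonneg _ _ (by norm_num) (by norm_num)]
    norm_num
  simp only [div_eq_mul_inv] at h ⊢
  norm_num at h hN ⊢
  rw [ENNReal.mul_rpow_of_nonneg _ _ (by norm_num), ENNReal.mul_rpow_of_nonneg _ _ (by norm_num)]
  calc _ ≤ _ := mul_le_mul_left h _
    _ = _ := by
      conv_lhs => rw [hN]
      ring

theorem sum_sign_mul_sign (i j : Fin n) (a b : Fin m) :
    ∑ ε : Signs n m, signVec ε i a * signVec ε j b =
      if i = j ∧ a = b then (Fintype.card (Signs n m) : ℝ) else 0 := by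
  simp only [signVec]
  split_ifs with h
  · obtain ⟨rfl, rfl⟩ := h
    have : ∀ u : ℤˣ, (((u : ℤ) : ℝ)) * ((u : ℤ) : ℝ) = 1 := fun u => by
      rcases Int.units_eq_one_or u with rfl | rfl <;> simp
    simp [this]
  -- Flipping the single sign at `(i, a)` permutes the sign tuples and negates the summand, so the
  -- sum equals its own negative.
  · let δ : Signs n m := Pi.mulSingle i (Pi.mulSingle a (-1))
    have h1 := Equiv.sum_comp (Equiv.mulRight δ)
      (fun ε : Signs n m => (((ε i a : ℤˣ) : ℤ) : ℝ) * (((ε j b : ℤˣ) : ℤ) : ℝ))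
    have hi : δ i a = -1 := by simp [δ]
    have hj : δ j b = 1 := by
      by_cases hij : i = j
      · subst hij
        have hab : b ≠ a := fun e => h ⟨rfl, e.symm⟩
        simp [δ, hab]
      · simp [δ, Pi.mulSingle_eq_of_ne (Ne.symm hij)]
    simp only [Equiv.coe_mulRight, Pi.mul_apply, hi, hj, mul_neg, mul_one, Units.val_neg,
      Int.cast_neg, neg_mul, Finset.sum_neg_distrib] at h1
    linarith

variable {V : Type*} [NormedAddCommGroup V] [InnerProductSpace ℝ V] [FiniteDimensional ℝ V]
  [MeasurableSpace V] [BorelSpace V]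

/-- Orthogonality of the signs leaves only the terms `k_s(xᵢ, xᵢ) M a a`. -/
theorem sum_kernelGram (s : ℝ) {M : Matrix (Fin m) (Fin m) ℝ} (hM : M.PosSemidef)
    (x : Fin n → V) :
    ∑ ε : Signs n m, kernelGram s M x (signVec ε) =
      (Fintype.card (Signs n m) : ℝ) * ((∑ i, sobKernel s (x i) (x i)) * M.trace) := by
  have h1 : ∀ ε : Signs n m, kernelGram s M x (signVec ε) = ∑ i, ∑ j, ∑ a, ∑ b,
      sobKernel s (x i) (x j) * M a b * (signVec ε i a * signVec ε j b) := by
    intro ε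
    unfold kernelGram gram
    refine Finset.sum_congr rfl fun i _ => ?_
    refine Finset.sum_congr rfl fun j _ => ?_
    rw [← inner_toEuclideanLin_sqrt, toEuclideanLin_sqrt_sqrt hM]
    simp only [PiLp.inner_apply, Matrix.toLpLin_apply, Matrix.mulVec, dotProduct, Finset.mul_sum,
      RCLike.inner_apply, conj_trivial, Finset.sum_mul]
    refine Finset.sum_congr rfl fun a _ => ?_
    refine Finset.sum_congr rfl fun b _ => ?_
    ring
  simp only [h1]
  rw [Finset.sum_comm, Finset.sum_mul, Finset.mul_sum]
  refine Finset.sum_congr rfl fun i _ => ?_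
  rw [Finset.sum_comm, Finset.sum_eq_single i]
  · rw [Finset.sum_comm, Matrix.trace, Finset.mul_sum, Finset.mul_sum]
    refine Finset.sum_congr rfl fun a _ => ?_
    rw [Finset.sum_comm, Finset.sum_eq_single a]
    · rw [← Finset.mul_sum, sum_sign_mul_sign, if_pos ⟨rfl, rfl⟩, Matrix.diag_apply, mul_comm]
    · intro b _ hb
      rw [← Finset.mul_sum, sum_sign_mul_sign, if_neg fun h => hb h.2.symm, mul_zero]
    · simp
  · intro j _ hj
    rw [Finset.sum_comm]
    refine Finset.sum_eq_zero fun a _ => ?_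
    rw [Finset.sum_comm]
    refine Finset.sum_eq_zero fun b _ => ?_
    rw [← Finset.mul_sum, sum_sign_mul_sign, if_neg fun h => hj h.1.symm, mul_zero]
  · simp

theorem expect_kernelGram_le {s : ℝ} (hs : (Module.finrank ℝ V : ℝ) / 2 < s)
    {M : Matrix (Fin m) (Fin m) ℝ} (hM : M.PosSemidef)
    (x : Fin n → V) {κ : ℝ} (hκ : ∀ y y' : V, sobKernel s y y' ≤ κ) :
    expect (fun ε : Signs n m => ENNReal.ofReal (kernelGram s M x (signVec ε))) ≤
      ENNReal.ofReal (n * κ * M.trace) := by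
  have hN : (0 : ℝ) < Fintype.card (Signs n m) := by exact_mod_cast Fintype.card_pos
  rw [expect, ← ENNReal.ofReal_sum_of_nonneg fun ε _ => kernelGram_nonneg hs x _,
    sum_kernelGram s hM, ← ENNReal.ofReal_natCast, ← ENNReal.ofReal_div_of_pos hN]
  apply ENNReal.ofReal_le_ofReal
  rw [mul_div_cancel_left₀ _ hN.ne']
  refine mul_le_mul_of_nonneg_right ?_ hM.trace_nonneg
  calc ∑ i, sobKernel s (x i) (x i) ≤ ∑ _i : Fin n, κ := Finset.sum_le_sum fun i _ => hκ _ _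
    _ = n * κ := by simp

end Expectation

/-! ### Norms of networks, layer by layer. -/

section Network

variable {d : ℕ → ℕ} {m : ℕ}

theorem layers_self (T : ∀ k, E (d k) → E (d (k + 1))) {i : ℕ} (x : E (d i)) :
    layers T le_rfl x = x :=
  Nat.leRecOn_self (C := fun k => E (d k)) (next := fun {k} => T k) x

theorem layers_succ_left (T : ∀ k, E (d k) → E (d (k + 1))) {i j : ℕ} (hij : i + 1 ≤ j)
    (x : E (d i)) : layers T hij (T i x) = layers T (Nat.le_of_succ_le hij) x :=
  Nat.leRecOn_succ_left (C := fun k => E (d k)) (next := fun {k} => T k) x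
    (Nat.le_of_succ_le hij) hij

variable {l : ℕ} {s : ℕ → ℝ} {M : Matrix (Fin m) (Fin m) ℝ} {C D : ℝ}
  {σ : ∀ k, E (d (k + 1)) → E (d (k + 1))} {B : ∀ k, Set (E (d (k + 1)))}
  {W : ∀ k, Matrix (Fin (d (k + 1))) (Fin (d k)) ℝ} {a : ∀ k, E (d (k + 1))}

theorem rkhsNorm_layer_le (hs : ∀ k ≤ l, (d k : ℝ) / 2 < s k) (k : Fin l)
    (hσ : koopmanNorm (s (k + 1)) M (σ k) < ∞)
    (hW : ∀ f : E (d (k + 1)) → E m, MemRkhs (s (k + 1)) M f →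
      MemRkhs (s k) M (fun x => f (Matrix.toEuclideanLin (W k) x)))
    (hdet : 0 < ((W k).transpose * W k).det) (h : E (d l) → E m)
    (hfin : MemRkhs (s (k + 1)) M fun x => h (layers (fullLayer σ W a) k.isLt x)) :
    MemRkhs (s k) M (fun x => h (layers (fullLayer σ W a) k.isLt.le x)) ∧
    rkhsNorm (s k) M (fun x => h (layers (fullLayer σ W a) k.isLt.le x)) ≤
      layerFactor s M σ W a h k *
        rkhsNorm (s (k + 1)) M fun x => h (layers (fullLayer σ W a) k.isLt x) := by
  have hs1 : (Module.finrank ℝ (E (d (k + 1))) : ℝ) / 2 < s (k + 1) := by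
    simpa using hs (k + 1) k.isLt
  set ψ : E (d (k + 1)) → E m := fun x => h (layers (fullLayer σ W a) k.isLt x) with hψ
  set t := tail σ W a h k with ht
  have hcomp : (fun x => h (layers (fullLayer σ W a) k.isLt.le x)) =
      fun x => t (Matrix.toEuclideanLin (W k) x) := by
    ext1 x
    rw [← layers_succ_left _ k.isLt]
    rfl
  have ht_le : rkhsNorm (s (k + 1)) M t ≤
      koopmanNorm (s (k + 1)) M (σ k) * rkhsNorm (s (k + 1)) M ψ :=
    (rkhsNorm_comp_add_le hs1 (a k) (fun y => ψ (σ k y))).trans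
      (rkhsNorm_comp_le_koopmanNorm hs1 (σ k) hfin)
  have ht_fin : rkhsNorm (s (k + 1)) M t < ∞ := ht_le.trans_lt (ENNReal.mul_lt_top hσ hfin)
  rw [hcomp]
  refine ⟨hW t ht_fin, ?_⟩
  -- `normRatio` times `‖t‖` recovers the norm on the range only if `‖t‖` is neither `0` nor `∞`; if
  -- it is `0`, then `t = 0` and so is the composition.
  rcases eq_or_ne (rkhsNorm (s (k + 1)) M t) 0 with h0 | h0
  · rw [eq_zero_of_rkhsNorm_eq_zero hs1 h0]
    exact (rkhsNorm_zero (V := E (d k))).le.trans zero_le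
  have h1 := rkhsNorm_comp_matrix_le (M := M) (hs k k.isLt.le) hdet t
  refine h1.trans ?_
  have h2 : rkhsNorm (s k) M
      (fun y : LinearMap.range (Matrix.toEuclideanLin (W k)) => t y) =
      normRatio (s k) (s (k + 1)) M (W k) t * rkhsNorm (s (k + 1)) M t := by
    rw [normRatio, ENNReal.div_mul_cancel h0 ht_fin.ne]
  rw [h2, layerFactor, ← ht, div_eq_mul_inv (koopmanNorm _ _ _)]
  refine (mul_le_mul_right (mul_le_mul_right ht_le _) _).trans (le_of_eq ?_)
  ring

/-- The norm of a network is at most the product of the layer factors times the norm of its upper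
part. -/
theorem rkhsNorm_network_le (hs : ∀ k ≤ l, (d k : ℝ) / 2 < s k) (hD : 0 < D)
    (hσ : ∀ k < l, koopmanNorm (s (k + 1)) M (σ k) < ∞)
    (hW : ∀ k < l, ∀ W ∈ weightSet C D (d k) (d (k + 1)), ∀ f : E (d (k + 1)) → E m,
      MemRkhs (s (k + 1)) M f → MemRkhs (s k) M (fun x => f (Matrix.toEuclideanLin W x)))
    (hp : LowerParams l C D B W a) {h : E (d l) → E m} (hh : MemRkhs (s l) M h) :
    MemRkhs (s 0) M (fun x => h (layers (fullLayer σ W a) (Nat.zero_le l) x)) ∧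
    rkhsNorm (s 0) M (fun x => h (layers (fullLayer σ W a) (Nat.zero_le l) x)) ≤
      (∏ k : Fin l, layerFactor s M σ W a h k) * rkhsNorm (s l) M h := by
  -- Descending induction from the output side: at stage `k` only the layers `j ≥ k` have been paid
  -- for.
  have key : ∀ k (hk : k ≤ l),
      MemRkhs (s k) M (fun x => h (layers (fullLayer σ W a) hk x)) ∧
      rkhsNorm (s k) M (fun x => h (layers (fullLayer σ W a) hk x)) ≤
        (∏ j ∈ Finset.univ.filter fun j : Fin l => k ≤ (j : ℕ), layerFactor s M σ W a h j) *
          rkhsNorm (s l) M h := by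
    intro k hk
    induction hk using Nat.decreasingInduction with
    | self =>
      simp only [layers_self]
      refine ⟨hh, ?_⟩
      rw [Finset.filter_false_of_mem fun j _ => not_le.mpr j.isLt, Finset.prod_empty, one_mul]
    | of_succ k hk ih =>
      have hstep := rkhsNorm_layer_le hs ⟨k, hk⟩ (hσ k hk) (hW k hk _ (hp k hk).1)
        (det_pos_of_mem_weightSet hD (hp k hk).1) h ih.1
      refine ⟨hstep.1, hstep.2.trans ?_⟩
      have hins : (Finset.univ.filter fun j : Fin l => k ≤ (j : ℕ)) =
          insert ⟨k, hk⟩ (Finset.univ.filter fun j : Fin l => k + 1 ≤ (j : ℕ)) := by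
        ext j
        simp only [Finset.mem_filter, Finset.mem_univ, true_and, Finset.mem_insert, Fin.ext_iff]
        omega
      rw [hins, Finset.prod_insert (by simp), mul_assoc]
      exact mul_le_mul_right ih.2 _
  have := key 0 (Nat.zero_le l)
  simpa using this

end Network

/-! ### From norms back to the complexity of the upper layers. -/

section Approximation

variable {V V₀ : Type*} {n m : ℕ}
  [NormedAddCommGroup V] [InnerProductSpace ℝ V] [FiniteDimensional ℝ V]
  [MeasurableSpace V] [BorelSpace V]
  [NormedAddCommGroup V₀] [InnerProductSpace ℝ V₀] [FiniteDimensional ℝ V₀]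
  [MeasurableSpace V₀] [BorelSpace V₀]

/-- With `b = ‖υ̃‖`, the coefficient `c = (A / b) * N / b` is chosen so that `⟨υ̃, c υ̃⟩ = c b² = A
N`. Splitting `c υ̃ = h' - (h' - c υ̃)` gives the two terms. -/
theorem mul_rkhsNorm_le {s : ℝ} (hs : (Module.finrank ℝ V : ℝ) / 2 < s)
    {M : Matrix (Fin m) (Fin m) ℝ} (hM : M.PosSemidef) (xt : Fin n → V) (ε : Signs n m)
    (hxt : kernelSum s M xt ε ≠ 0) {A N : ℝ≥0∞} (hA : A ≠ ∞) (hN : N ≠ ∞) (h' : V → E m) :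
    A * N ≤ ‖∑ i, inner ℝ (signVec ε i) (h' (xt i))‖ₑ +
      rkhsNorm s M (fun y => h' y -
        (A / rkhsNorm s M (kernelSum s M xt ε) * N / rkhsNorm s M (kernelSum s M xt ε)).toReal •
          kernelSum s M xt ε y) * rkhsNorm s M (kernelSum s M xt ε) := by
  have hb := rkhsNorm_kernelSum hs hM xt ε
  set Q := kernelGram s M xt (signVec ε) with hQ
  have hQ0 : 0 ≤ Q := kernelGram_nonneg hs xt _
  have hb0 : rkhsNorm s M (kernelSum s M xt ε) ≠ 0 :=
    fun h0 => hxt (eq_zero_of_rkhsNorm_eq_zero hs h0)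
  set b := rkhsNorm s M (kernelSum s M xt ε) with hbdef
  have hbt : b ≠ ∞ := hb ▸ ENNReal.ofReal_ne_top
  have hbQ : b * b = ENNReal.ofReal Q := by
    rw [hb, ← ENNReal.ofReal_mul (Real.sqrt_nonneg _), Real.mul_self_sqrt hQ0]
  set c := (A / b * N / b).toReal with hc
  have hct : A / b * N / b ≠ ∞ :=
    ENNReal.div_ne_top (ENNReal.mul_ne_top (ENNReal.div_ne_top hA hb0) hN) hb0
  have hcQ : A * N = ‖c * Q‖ₑ := by
    rw [enorm_mul, hc, Real.enorm_of_nonneg ENNReal.toReal_nonneg, ENNReal.ofReal_toReal hct,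
      Real.enorm_of_nonneg hQ0, ← hbQ, ← mul_assoc, ENNReal.div_mul_cancel hb0 hbt, mul_right_comm,
      ENNReal.div_mul_cancel hb0 hbt]
  set r := fun y => h' y - c • kernelSum s M xt ε y with hr
  have hsplit : c * Q = ∑ i, inner ℝ (signVec ε i) (h' (xt i)) -
      ∑ i, inner ℝ (signVec ε i) (r (xt i)) := by
    simp only [hr, inner_sub_right, inner_smul_right, Finset.sum_sub_distrib, ← Finset.mul_sum,
      sum_inner_kernelSum hM, ← hQ]
    ring
  rw [hcQ, hsplit]
  refine (enorm_sub_le).trans ?_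
  gcongr
  rcases eq_or_ne (rkhsNorm s M r) ∞ with ht | ht
  · rw [ht, ENNReal.top_mul hb0]
    exact le_top
  · rw [mul_comm, hb]
    exact enorm_sum_inner_le_rkhsNorm hs xt (signVec ε) ht.lt_top

/-- The expected product of the norms of the sample functional and of the upper layers is bounded by
their Rademacher complexity, up to the approximation error. -/
theorem expect_iSup_rkhsNorm_le {s₀ s : ℝ} (hs₀ : (Module.finrank ℝ V₀ : ℝ) / 2 < s₀)
    (hs : (Module.finrank ℝ V : ℝ) / 2 < s)
    {M : Matrix (Fin m) (Fin m) ℝ} (hM : M.PosSemidef) (x : Fin n → V₀) (xt : Fin n → V)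
    (hxt : ∀ ε : Signs n m, kernelSum s M xt ε ≠ 0)
    {κ : ℝ} (hκ : ∀ y y' : V, sobKernel s y y' ≤ κ)
    {F : Set (V → E m)} (hF : F.Nonempty) (hFmem : ∀ h ∈ F, MemRkhs s M h) :
    expect (fun ε : Signs n m =>
        ⨆ h ∈ F, rkhsNorm s₀ M (kernelSum s₀ M x ε) * rkhsNorm s M h / (n : ℝ≥0∞)) ≤
      rademacher xt F +
        ENNReal.ofReal (Real.sqrt (κ / n * M.trace)) * approxTerm s₀ s M x xt F := by
  have hn : 0 < n := by
    rcases Nat.eq_zero_or_pos n with rfl | h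
    · exact absurd (by ext y; simp [kernelSum]) (hxt 1)
    · exact h
  have hn' : (n : ℝ) ≠ 0 := by positivity
  set c := ENNReal.ofReal (Real.sqrt (κ / n * M.trace)) with hc
  have hB : expect (fun ε : Signs n m => (rkhsNorm s M (kernelSum s M xt ε) / n) ^ 2) ^ (1 / 2 : ℝ)
      ≤ c := by
    have h1 : ∀ ε : Signs n m, (rkhsNorm s M (kernelSum s M xt ε) / n) ^ 2 =
        ENNReal.ofReal ((n : ℝ) ^ 2)⁻¹ *
          ENNReal.ofReal (kernelGram s M xt (signVec ε)) := by
      intro ε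
      have hQ0 := kernelGram_nonneg (M := M) hs xt (signVec ε)
      rw [rkhsNorm_kernelSum hs hM, ← ENNReal.ofReal_natCast n,
        ← ENNReal.ofReal_div_of_pos (by positivity), ← ENNReal.ofReal_pow (by positivity),
        ← ENNReal.ofReal_mul (by positivity), div_pow, Real.sq_sqrt hQ0, div_eq_inv_mul]
    simp only [h1]
    rw [expect_const_mul]
    have h2 := mul_le_mul_right (expect_kernelGram_le hs hM xt hκ)
      (ENNReal.ofReal ((n : ℝ) ^ 2)⁻¹)
    rw [← ENNReal.ofReal_mul (by positivity)] at h2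
    refine (ENNReal.rpow_le_rpow h2 (by norm_num)).trans (le_of_eq ?_)
    -- The sign of `κ` comes from the diagonal of the kernel.
    have hκ0 : 0 ≤ κ := (sobKernel_self_nonneg s (0 : V)).trans (hκ 0 0)
    have htr := hM.trace_nonneg
    rw [ENNReal.ofReal_rpow_of_nonneg (by positivity) (by norm_num), hc, Real.sqrt_eq_rpow]
    congr 2
    field_simp
  set Y := expect (fun ε : Signs n m =>
    ⨆ h ∈ F, rkhsNorm s₀ M (kernelSum s₀ M x ε) * rkhsNorm s M h / (n : ℝ≥0∞)) with hY
  set G : (V → E m) → ℝ≥0∞ := fun h' => expect (fun ε : Signs n m => ⨆ h'' ∈ F,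
    rkhsNorm s M (fun y => h' y -
      (rkhsNorm s₀ M (kernelSum s₀ M x ε) / rkhsNorm s M (kernelSum s M xt ε) *
        rkhsNorm s M h'' / rkhsNorm s M (kernelSum s M xt ε)).toReal •
          kernelSum s M xt ε y) ^ 2) ^ (1 / 2 : ℝ) with hG
  have key : ∀ h' ∈ F, Y ≤ rademacher xt F + c * G h' := by
    intro h' hh'
    set S : Signs n m → ℝ≥0∞ := fun ε => ⨆ h'' ∈ F, rkhsNorm s M (fun y => h' y -
      (rkhsNorm s₀ M (kernelSum s₀ M x ε) / rkhsNorm s M (kernelSum s M xt ε) *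
        rkhsNorm s M h'' / rkhsNorm s M (kernelSum s M xt ε)).toReal •
          kernelSum s M xt ε y) ^ 2 with hS
    have hroot : ∀ t : ℝ≥0∞, (t ^ 2) ^ (1 / 2 : ℝ) = t := fun t => by
      rw [← ENNReal.rpow_natCast, ← ENNReal.rpow_mul]; norm_num
    have h1 : ∀ ε : Signs n m,
        (⨆ h ∈ F, rkhsNorm s₀ M (kernelSum s₀ M x ε) * rkhsNorm s M h / (n : ℝ≥0∞)) ≤
        (⨆ f ∈ F, ‖∑ i, inner ℝ (signVec ε i) (f (xt i))‖ₑ / (n : ℝ≥0∞)) +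
          S ε ^ (1 / 2 : ℝ) *
            ((rkhsNorm s M (kernelSum s M xt ε) / n) ^ 2) ^ (1 / 2 : ℝ) := by
      intro ε
      refine iSup₂_le fun h hh => ?_
      have hA : rkhsNorm s₀ M (kernelSum s₀ M x ε) ≠ ∞ := by
        rw [rkhsNorm_kernelSum hs₀ hM]; exact ENNReal.ofReal_ne_top
      have h2 := mul_rkhsNorm_le hs hM xt ε (hxt ε) hA (hFmem h hh).ne h'
      refine (ENNReal.div_le_div_right h2 _).trans ?_
      rw [ENNReal.add_div, hroot, mul_div_assoc]
      gcongr
      · exact le_iSup₂_of_le (f := fun (f : V → E m) (_ : f ∈ F) =>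
          ‖∑ i, inner ℝ (signVec ε i) (f (xt i))‖ₑ / (n : ℝ≥0∞)) h' hh' le_rfl
      · conv_lhs => rw [← hroot (rkhsNorm s M _)]
        gcongr
        exact le_iSup₂_of_le (f := fun (h'' : V → E m) (_ : h'' ∈ F) =>
          rkhsNorm s M (fun y => h' y -
            (rkhsNorm s₀ M (kernelSum s₀ M x ε) / rkhsNorm s M (kernelSum s M xt ε) *
              rkhsNorm s M h'' / rkhsNorm s M (kernelSum s M xt ε)).toReal •
                kernelSum s M xt ε y) ^ 2) h hh le_rfl
    refine (expect_mono h1).trans ?_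
    rw [expect_add]
    refine add_le_add le_rfl ((expect_mul_le _ _).trans ?_)
    rw [mul_comm c]
    exact mul_le_mul_right hB _
  have happ : approxTerm s₀ s M x xt F = ⨅ h' ∈ F, G h' := rfl
  -- Truncated subtraction isolates `c` times the infimum, so that `key` can be used for each `h'`
  -- separately. Moving `c` into the infimum needs `c ≠ 0`; for `c = 0` one element of `F` suffices.
  rw [← tsub_le_iff_left, happ]
  rcases eq_or_ne c 0 with h0 | h0
  · obtain ⟨h', hh'⟩ := hF
    have := key h' hh'
    rw [h0, zero_mul, ← tsub_le_iff_left] at this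
    rwa [h0, zero_mul]
  · rw [ENNReal.mul_iInf_of_ne h0 ENNReal.ofReal_ne_top]
    refine le_iInf fun h' => ?_
    rw [ENNReal.mul_iInf_of_ne h0 ENNReal.ofReal_ne_top]
    exact le_iInf fun hh' => tsub_le_iff_left.mpr (key h' hh')

end Approximation

end KoopmanNet

end

/-! ### The Rademacher bound for deep networks. -/

open KoopmanNet in
theorem mainTheorem1
    (n m L l : ℕ) (hl : l ≤ L) (d : ℕ → ℕ)
    -- orders of smoothness, and the matrix of the reproducing kernels
    (s : ℕ → ℝ) (hs : ∀ k ≤ L, (d k : ℝ) / 2 < s k)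
    (M : Matrix (Fin m) (Fin m) ℝ) (hM : M.PosSemidef)
    (C D : ℝ) (hC : 0 < C) (hD : 0 < D)
    -- activation functions, bias sets, final transformation
    (σ : ∀ k, E (d (k + 1)) → E (d (k + 1)))
    (B : ∀ k, Set (E (d (k + 1))))
    (g : E (d L) → E m) (hg : MemRkhs (s L) M g)
    -- the Koopman operators of the lower layers act between the function spaces
    (hσ : ∀ k < l, koopmanNorm (s (k + 1)) M (σ k) < ⊤)
    (hW : ∀ k < l, ∀ W ∈ weightSet C D (d k) (d (k + 1)), ∀ f : E (d (k + 1)) → E m,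
      MemRkhs (s (k + 1)) M f → MemRkhs (s k) M (fun x => f (Matrix.toEuclideanLin W x)))
    -- the class of upper layers
    (F : Set (E (d l) → E m)) (hF : F.Nonempty)
    (hFnet : F ⊆ upperNetworks hl σ g) (hFmem : ∀ h ∈ F, MemRkhs (s l) M h)
    -- the sample, and the points in the domain of the upper layers
    (x : Fin n → E (d 0)) (xt : Fin n → E (d l))
    (hxt : ∀ ε : Signs n m, kernelSum (s l) M xt ε ≠ 0)
    (κ : ℝ) (hκ : ∀ y y' : E (d l), sobKernel (s l) y y' ≤ κ) :
    rademacher x {f | ∃ h ∈ F, ∃ f₂ ∈ lowerNetworks l C D B σ, f = h ∘ f₂} ≤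
      (⨆ (W : ∀ k, Matrix (Fin (d (k + 1))) (Fin (d k)) ℝ) (a : ∀ k, E (d (k + 1)))
          (_ : LowerParams l C D B W a) (h ∈ F),
        ∏ k : Fin l, layerFactor s M σ W a h k) *
      (rademacher xt F +
        ENNReal.ofReal (Real.sqrt (κ / n * M.trace)) * approxTerm (s 0) (s l) M x xt F) := by
  have hs' : ∀ k ≤ l, (d k : ℝ) / 2 < s k := fun k hk => hs k (hk.trans hl)
  have hs₀ : (Module.finrank ℝ (E (d 0)) : ℝ) / 2 < s 0 := by simpa using hs 0 (Nat.zero_le L)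
  have hsl : (Module.finrank ℝ (E (d l)) : ℝ) / 2 < s l := by simpa using hs l hl
  refine le_trans ?_
    (mul_le_mul_right (expect_iSup_rkhsNorm_le hs₀ hsl hM x xt hxt hκ hF hFmem) _)
  -- The supremum of the layer products does not depend on the signs, so it may enter the
  -- expectation and the bound is proved for each `ε`.
  rw [← expect_const_mul]
  refine expect_mono fun ε => iSup₂_le ?_
  rintro _ ⟨h, hh, _, ⟨W, a, hp, rfl⟩, rfl⟩
  obtain ⟨hmem, hle⟩ := rkhsNorm_network_le (s := s) hs' hD hσ hW hp (hFmem h hh)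
  have h1 := enorm_sum_inner_le_rkhsNorm hs₀ x (signVec ε) hmem
  rw [← rkhsNorm_kernelSum hs₀ hM] at h1
  have hprod : ∏ k : Fin l, layerFactor s M σ W a h k ≤
      ⨆ (W : ∀ k, Matrix (Fin (d (k + 1))) (Fin (d k)) ℝ) (a : ∀ k, E (d (k + 1)))
        (_ : LowerParams l C D B W a) (h ∈ F), ∏ k : Fin l, layerFactor s M σ W a h k :=
    le_iSup_of_le W (le_iSup_of_le a (le_iSup_of_le hp (le_iSup₂_of_le h hh le_rfl)))
  have hsup : rkhsNorm (s 0) M (kernelSum (s 0) M x ε) * rkhsNorm (s l) M h / (n : ENNReal) ≤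
      ⨆ h ∈ F, rkhsNorm (s 0) M (kernelSum (s 0) M x ε) * rkhsNorm (s l) M h / (n : ENNReal) :=
    le_iSup₂_of_le (f := fun (h : E (d l) → E m) (_ : h ∈ F) =>
      rkhsNorm (s 0) M (kernelSum (s 0) M x ε) * rkhsNorm (s l) M h / (n : ENNReal)) h hh le_rfl
  -- The same `h` occurs in both factors; bounding each by its own supremum decouples them.
  refine le_trans ?_ (mul_le_mul' hprod hsup)
  rw [← mul_div_assoc]
  refine ENNReal.div_le_div_right ((h1.trans (mul_le_mul_right hle _)).trans (le_of_eq ?_)) _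
  ring
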